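/- Let $0<\alpha\le 4$ and $c_1=\tfrac12+\tfrac16\sqrt{-3+12\alpha^{-1}}$. A real number $\rho$ is of type $\nu$ if there is $K>0$ with $|\rho-\tfrac mn|\ge K|n|^{-2-\nu}$ for all integers $m$ and $n\neq 0$; its minimal type index is $\nu_\rho=\infty$ if $\rho\in\mathbb Q$, and $\nu_\rho=\inf\{\nu>0:\rho\text{ is of type }\nu\}\in[0,\infty]$ if $\rho\notin\mathbb Q$ (with $\inf\emptyset=\infty$). Let $\mathbb T=\mathbb R/2\pi\mathbb Z$ and $\langle x\rangle=1+|x|$, and let $\widehat u(n,\tau)$, $(n,\tau)\in\mathbb Z\times\mathbb R$, be the space-time Fourier transform of a distribution $u$ on $\mathbb T\times\mathbb R$. For functions $v$ on $\mathbb T\times\mathbb R$ put $$\|v\|_{Y_\alpha^{s_1,s_2}}=\big\|\langle n\rangle^{s_1}\langle\tau-\alpha n^3\rangle^{\frac12}\widehat v\big\|_{L^2_nL^2_\tau}+\big\|\langle n\rangle^{s_1}\widehat v\big\|_{L^2_nL^1_\tau}+\big\|\langle n\rangle^{s_2}\langle\tau-\alpha n^3\rangle^{\frac12}\widehat v\big\|_{L^\infty_nL^2_\tau}+\big\|\langle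 n\rangle^{s_2}\widehat v\big\|_{L^\infty_nL^1_\tau},$$ and for distributions $w$ put $$\|w\|_{Z^{s_2,\infty}}=\big\|\langle n\rangle^{s_2}\langle\tau-n^3\rangle^{-\frac12}\widehat w\big\|_{L^\infty_nL^2_\tau}+\big\|\langle n\rangle^{s_2}\langle\tau-n^3\rangle^{-1}\widehat w\big\|_{L^\infty_nL^1_\tau}.$$ For $s_1\ge 0$ let $Y_\alpha^{s_1,s_2}$ be the space of all (complex-valued) $v\in L^2(\mathbb T\times\mathbb R)$ with $\|v\|_{Y_\alpha^{s_1,s_2}}<\infty$. **Proposition.** Assume $\nu_{c_1}<1$ and $\tfrac14\le s_1<\tfrac12<s_2<1$ with $2s_1>s_2>\tfrac12+\tfrac12\nu_{c_1}$. Then there is a constant $C=C(\alpha,s_1,s_2)<\infty$ such that for all $v_1,v_2\in Y_\alpha^{s_1,s_2}$ $$\|\partial_x(v_1v_2)\|_{Z^{s_2,\infty}}\le C\,\|v_1\|_{Y_\alpha^{s_1,s_2}}\|v_2\|_{Y_\alpha^{s_1,s_2}},$$ where $\partial_x(v_1v_2)$ is the distributional derivative of the product $v_1v_2\in L^1(\mathbb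 T\times\mathbb R)$. -/

import Mathlib

open MeasureTheory
open scoped ENNReal NNReal SchwartzMap

noncomputable section

namespace MajdaBiello

/-! ### Diophantine type -/

/-- `ρ` is of type `ν`: for some `K > 0`, `|ρ - m / n| ≥ K / |n| ^ (2 + ν)` for all integers `m, n`
(with `n ≠ 0`, so that the fraction makes sense). -/
def IsOfType (ρ ν : ℝ) : Prop :=
  ∃ K : ℝ, 0 < K ∧ ∀ m n : ℤ, n ≠ 0 → K / |(n : ℝ)| ^ (2 + ν) ≤ |ρ - (m : ℝ) / (n : ℝ)|

open Classical in
/-- The minimal type index `ν_ρ ∈ [0, ∞]`: it is `∞` for rational `ρ`, and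
`inf {ν > 0 : ρ is of type ν}` (with `inf ∅ = ∞`) for irrational `ρ`. -/
def minimalTypeIndex (ρ : ℝ) : ℝ≥0∞ :=
  if Irrational ρ then sInf (ENNReal.ofReal '' {ν : ℝ | 0 < ν ∧ IsOfType ρ ν}) else ⊤

/-- The root `c₁ = 1/2 + √(-3 + 12/α) / 6` of the resonance equation. -/
def c₁ (α : ℝ) : ℝ := 1 / 2 + √(-3 + 12 * α⁻¹) / 6

/-! ### Space-time distributions and their Fourier transforms -/

instance factTwoPiPos : Fact (0 < 2 * Real.pi) := ⟨Real.two_pi_pos⟩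

/-- The circle `𝕋 = ℝ / 2πℤ`, with its Lebesgue measure of total mass `2π`. -/
abbrev Circle2Pi : Type := AddCircle (2 * Real.pi)

/-- Complex-valued functions on space-time `𝕋 × ℝ`, with points `(x, t)`. -/
abbrev SpaceTimeFun : Type := Circle2Pi × ℝ → ℂ

/-- Distributions on `𝕋 × ℝ`, as functionals acting on test functions. -/
abbrev Functional : Type := SpaceTimeFun → ℂ

/-- The distribution `φ ↦ ∫ w φ dx dt` given by a function `w`. -/
def ofFun (w : SpaceTimeFun) : Functional := fun φ => ∫ p, w p * φ p

/-- The classical derivative of a function with respect to `x`. -/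
def derivX (φ : SpaceTimeFun) : SpaceTimeFun :=
  fun p => deriv (fun y : ℝ => φ (p.1 + (y : Circle2Pi), p.2)) 0

/-- The distributional derivative `∂ₓ`: `⟨∂ₓ u, φ⟩ = -⟨u, ∂ₓ φ⟩`. -/
def distDerivX (u : Functional) : Functional := fun φ => -u (derivX φ)

/-- The test function `(x, t) ↦ e^{-i n x} ∫ e^{-i t τ} ψ(τ) dτ`, that is, the Fourier transform
of `ψ` placed at the frequency `n`. -/
def testFun (n : ℤ) (ψ : 𝓢(ℝ, ℂ)) : SpaceTimeFun :=
  fun p => fourier (-n) p.1 * ∫ τ : ℝ, Complex.exp (-Complex.I * (p.2 : ℂ) * (τ : ℂ)) * ψ τ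

/-- The distribution `u` has as its space-time Fourier transform the function
`(n, τ) ↦ V n τ` on `ℤ × ℝ`; formally `V n τ = ∫∫ u(x, t) e^{-i (n x + τ t)} dx dt`. As usual for
distributions, this is tested by moving the Fourier transform to the test function. -/
structure IsFourierTransform (u : Functional) (V : ℤ → ℝ → ℂ) : Prop where
  aestronglyMeasurable : ∀ n, AEStronglyMeasurable (V n) volume
  integrable : ∀ (n : ℤ) (ψ : 𝓢(ℝ, ℂ)), Integrable (fun τ => V n τ * ψ τ)
  apply_testFun : ∀ (n : ℤ) (ψ : 𝓢(ℝ, ℂ)), u (testFun n ψ) = ∫ τ, V n τ * ψ τ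

/-! ### The norms -/

/-- The bracket `⟨x⟩ = 1 + |x|`. -/
def jb (x : ℝ) : ℝ := 1 + |x|

/-- The mixed norm `‖F‖_{L^q_n L^p_τ}` on `ℤ × ℝ` (counting measure times Lebesgue measure). -/
def mixedNorm (q p : ℝ≥0∞) (F : ℤ → ℝ → ℂ) : ℝ≥0∞ :=
  eLpNorm (fun n : ℤ => eLpNorm (F n) p volume) q Measure.count

/-- The weighted function `⟨n⟩^s ⟨τ - α n³⟩^b V(n, τ)`. -/
def weighted (α s b : ℝ) (V : ℤ → ℝ → ℂ) : ℤ → ℝ → ℂ :=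
  fun n τ => ((jb n ^ s * jb (τ - α * (n : ℝ) ^ 3) ^ b : ℝ) : ℂ) * V n τ

/-- The `Y_α^{s₁}` norm `‖v‖_{X_α^{s₁,1/2}} + ‖⟨n⟩^{s₁} v̂‖_{L²_n L¹_τ}` in terms of `V = v̂`. -/
def hatYNorm (α s₁ : ℝ) (V : ℤ → ℝ → ℂ) : ℝ≥0∞ :=
  mixedNorm 2 2 (weighted α s₁ (1 / 2) V) + mixedNorm 2 1 (weighted α s₁ 0 V)

/-- The `Y_α^{s₂,∞}` norm `‖v‖_{X_α^{s₂,∞,1/2}} + ‖⟨n⟩^{s₂} v̂‖_{L^∞_n L¹_τ}` in terms of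
`V = v̂`. -/
def hatYInftyNorm (α s₂ : ℝ) (V : ℤ → ℝ → ℂ) : ℝ≥0∞ :=
  mixedNorm ∞ 2 (weighted α s₂ (1 / 2) V) + mixedNorm ∞ 1 (weighted α s₂ 0 V)

/-- The `Z^{s₂,∞}` norm `‖w‖_{X^{s₂,∞,-1/2}} + ‖⟨n⟩^{s₂} ⟨τ - n³⟩⁻¹ ŵ‖_{L^∞_n L¹_τ}` in terms of
`W = ŵ`. -/
def hatZInftyNorm (s₂ : ℝ) (W : ℤ → ℝ → ℂ) : ℝ≥0∞ :=
  mixedNorm ∞ 2 (weighted 1 s₂ (-1 / 2) W) + mixedNorm ∞ 1 (weighted 1 s₂ (-1) W)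

/-- `‖v‖_{Y_α^{s₁,s₂}} = ‖v‖_{Y_α^{s₁}} + ‖v‖_{Y_α^{s₂,∞}}`. The Fourier transform is unique up to
null sets when it is a function, so the infimum is over equal values; it is `∞` if there is no such
function. -/
def yNorm (α s₁ s₂ : ℝ) (v : SpaceTimeFun) : ℝ≥0∞ :=
  ⨅ (V : ℤ → ℝ → ℂ) (_ : IsFourierTransform (ofFun v) V), hatYNorm α s₁ V + hatYInftyNorm α s₂ V

/-- `‖u‖_{Z^{s₂,∞}}` of a distribution `u` on `𝕋 × ℝ` (`∞` if the Fourier transform of `u` is not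
a function). -/
def zInftyNorm (s₂ : ℝ) (u : Functional) : ℝ≥0∞ :=
  ⨅ (W : ℤ → ℝ → ℂ) (_ : IsFourierTransform u W), hatZInftyNorm s₂ W

/-- Membership in `Y_α^{s₁,s₂}` for `s₁ ≥ 0`. For such `s₁` the norm dominates the norm of
`L²(𝕋 × ℝ)`, so the elements of the space are square integrable functions. -/
def MemY (α s₁ s₂ : ℝ) (v : SpaceTimeFun) : Prop :=
  MemLp v 2 volume ∧ yNorm α s₁ s₂ v < ∞

end MajdaBiello

end

/-!
# The bilinear estimate for the coupled system of Majda and Biello at dispersion ratio `α`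

The product `v₁ v₂` sends a mode `m` of `v₁` and a mode `n - m` of `v₂` to the mode `n`. The
modulations `τ - n³`, `τ₁ - α m³` and `τ₂ - α (n - m)³` of the three modes differ by the resonance
function, which factors as `3 α n (m - c₁ n) ((n - m) - c₁ n)` (`resonance_eq`). So one of the three
modulations is at least a third of it (`resonance_mul_lconv_le`). If the output has the large
modulation, it is paid for by the weights of the `Z` norm; if an input has it, by the `X^{s,1/2}`
part of the `Y` norm of that input. With Young's inequality `L¹ * L² → L²` in `τ`, every single
interaction is therefore bounded in both parts of the `Z` norm by the product of the norms of the
two modes, with a gain of the square root of the resonance function (`resonance_mul_eLpNorm_le`,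
`resonance_mul_lintegral_le`).

It remains to sum over `m` (`tsum_weight_mul_le`), where that gain has to make up for the weight
`|n| ⟨n⟩ ^ s₂`. This is the arithmetic inequality `exists_weight_le`. If `m` and `n - m` are at
distance at least `1/2` from `c₁ n`, the gain and the weights `⟨m⟩ ^ s₁ ⟨n - m⟩ ^ s₁` suffice,
because `s₂ < 2 s₁` and `s₁ < 1/2`, and the sum is closed by the Cauchy-Schwarz inequality in `ℓ²`.
At most two values of `m` remain. For these both inputs have frequency comparable to `n`, the type
`ν < 2 s₂ - 1` of `c₁` bounds the resonance function below by `|n| ^ (1 - ν)`, and the weights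
`⟨m⟩ ^ s₂ ⟨n - m⟩ ^ s₂` of the `ℓ^∞` part of the norm suffice.

To pass from distributions to these computations, the Fourier transform of `∂ₓ (v₁ v₂)` has to be
identified with the series of convolutions (`isFourierTransform_derivProdFT`). The modes of an
element of `Y` are integrable in `τ` and square summable in `n`, but need not be absolutely
summable, so the series comes from Parseval's identity on the circle at almost every time
(`hasSum_fourier_mul`, `integral_mul_testFun`), once the spatial Fourier coefficients of `v` are
known to be the inverse Fourier transforms of its modes (`IsFourierTransform.ae_fourier_eq`).
-/

noncomputable section

namespace MajdaBiello

/-! ### The bracket and the resonance function -/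

lemma one_le_jb (x : ℝ) : 1 ≤ jb x := by
  unfold jb; linarith [abs_nonneg x]

lemma jb_pos (x : ℝ) : 0 < jb x := lt_of_lt_of_le one_pos (one_le_jb x)

lemma jb_rpow_nonneg (x r : ℝ) : 0 ≤ jb x ^ r := Real.rpow_nonneg (jb_pos x).le r

lemma sqrt_jb_add_le (x y z : ℝ) :
    jb (x + y + z) ^ (1 / 2 : ℝ) ≤ jb x ^ (1 / 2 : ℝ) + jb y ^ (1 / 2 : ℝ) + jb z ^ (1 / 2 : ℝ) := by
  have hx := jb_pos x
  have hy := jb_pos y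
  have hz := jb_pos z
  have h : jb (x + y + z) ≤ jb x + jb y + jb z := by
    have := abs_add_three x y z
    unfold jb; linarith
  calc jb (x + y + z) ^ (1 / 2 : ℝ) ≤ (jb x + jb y + jb z) ^ (1 / 2 : ℝ) :=
        Real.rpow_le_rpow (jb_pos _).le h (by norm_num)
    _ ≤ (jb x + jb y) ^ (1 / 2 : ℝ) + jb z ^ (1 / 2 : ℝ) :=
        Real.rpow_add_le_add_rpow (by positivity) hz.le (by norm_num) (by norm_num)
    _ ≤ _ := by
        gcongr
        exact Real.rpow_add_le_add_rpow hx.le hy.le (by norm_num) (by norm_num)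

/-- The resonance function `n³ - α m³ - α (n - m)³` of the interaction `(m, n - m) → n`: the
difference between the modulation of the output and the modulations of the two inputs. -/
def resonance (α : ℝ) (n m : ℤ) : ℝ :=
  (n : ℝ) ^ 3 - α * (m : ℝ) ^ 3 - α * ((n - m : ℤ) : ℝ) ^ 3

lemma c₁_sq_sub (α : ℝ) (hα : 0 < α) (hα4 : α ≤ 4) :
    3 * α * (c₁ α ^ 2 - c₁ α) = 1 - α := by
  have h : 0 ≤ -3 + 12 * α⁻¹ := by
    have : (4 : ℝ)⁻¹ ≤ α⁻¹ := inv_anti₀ hα hα4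
    linarith
  have hs := Real.sq_sqrt h
  have : c₁ α ^ 2 - c₁ α = √(-3 + 12 * α⁻¹) ^ 2 / 36 - 1 / 4 := by
    unfold c₁; ring
  rw [this, hs]
  field_simp
  ring

/-- The resonance function factors, and for `n ≠ 0` it vanishes only on the lines
`m = c₁ n` and `n - m = c₁ n`. -/
lemma resonance_eq (α : ℝ) (hα : 0 < α) (hα4 : α ≤ 4) (n m : ℤ) :
    resonance α n m =
      3 * α * n * ((m - c₁ α * n) * (((n - m : ℤ) : ℝ) - c₁ α * n)) := by
  have h := c₁_sq_sub α hα hα4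
  unfold resonance
  push_cast
  linear_combination (-(n : ℝ) ^ 3) * h

/-- Powers of `N` lost to the derivative are recovered from a lower bound for the resonance
function and one for the product of the input brackets, once the exponents add up. -/
lemma weight_le_of_exponents {N h X Y a b p q s s₂ : ℝ} (hN : 1 ≤ N) (ha : 0 < a) (hb : 0 < b)
    (hb1 : b ≤ 1) (hs : 0 ≤ s) (hs1 : s ≤ 1) (h2 : 0 ≤ s₂) (h21 : s₂ ≤ 1) (hX : 0 < X) (hY : 0 < Y)
    (hh : a * N ^ p ≤ h) (hP : b * N ^ q ≤ X * Y) (hpq : 1 + s₂ ≤ p / 2 + s * q) :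
    N * (1 + N) ^ s₂ ≤ 2 / (√a * b) * (1 + h) ^ (1 / 2 : ℝ) * (X ^ s * Y ^ s) := by
  have hN0 : 0 < N := by linarith
  have hh0 : 0 ≤ h := le_trans (by positivity) hh
  have e1 : N * (1 + N) ^ s₂ ≤ 2 * N ^ (p / 2 + s * q) := by
    have : (1 + N) ^ s₂ ≤ (2 * N) ^ s₂ := Real.rpow_le_rpow (by positivity) (by linarith) h2
    have h3 : (2 * N) ^ s₂ ≤ 2 * N ^ s₂ := by
      rw [Real.mul_rpow (by norm_num) hN0.le]
      gcongr
      calc (2 : ℝ) ^ s₂ ≤ 2 ^ (1 : ℝ) := Real.rpow_le_rpow_of_exponent_le (by norm_num) h21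
        _ = 2 := Real.rpow_one 2
    calc N * (1 + N) ^ s₂ ≤ N * (2 * N ^ s₂) := by gcongr; exact this.trans h3
      _ = 2 * N ^ (1 + s₂) := by rw [Real.rpow_add hN0, Real.rpow_one]; ring
      _ ≤ _ := by gcongr
  have e2 : √a * N ^ (p / 2) ≤ (1 + h) ^ (1 / 2 : ℝ) := by
    rw [Real.sqrt_eq_rpow, div_eq_mul_one_div p 2, Real.rpow_mul hN0.le,
      ← Real.mul_rpow ha.le (by positivity)]
    exact Real.rpow_le_rpow (by positivity) (by linarith) (by norm_num)
  have e3 : b * N ^ (s * q) ≤ X ^ s * Y ^ s := by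
    rw [← Real.mul_rpow hX.le hY.le]
    calc b * N ^ (s * q) ≤ b ^ s * N ^ (s * q) := by
          gcongr
          calc b = b ^ (1 : ℝ) := (Real.rpow_one b).symm
            _ ≤ b ^ s := Real.rpow_le_rpow_of_exponent_ge hb hb1 hs1
      _ = (b * N ^ q) ^ s := by
          rw [Real.mul_rpow hb.le (by positivity), mul_comm s q, Real.rpow_mul hN0.le]
      _ ≤ _ := Real.rpow_le_rpow (by positivity) hP hs
  calc N * (1 + N) ^ s₂ ≤ 2 * N ^ (p / 2 + s * q) := e1
    _ = 2 / (√a * b) * ((√a * N ^ (p / 2)) * (b * N ^ (s * q))) := by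
        have : √a ≠ 0 := (Real.sqrt_pos.2 ha).ne'
        rw [Real.rpow_add hN0]; field_simp
    _ ≤ 2 / (√a * b) * ((1 + h) ^ (1 / 2 : ℝ) * (X ^ s * Y ^ s)) := by gcongr
    _ = _ := by ring

/-- The hypothesis on the minimal type index provides a Diophantine exponent that the weight
`⟨n⟩ ^ s₂` can absorb. -/
lemma exists_isOfType_of_index_lt {ρ s₂ : ℝ} (hν : minimalTypeIndex ρ < 1)
    (h : 1 / 2 + minimalTypeIndex ρ / 2 < ENNReal.ofReal s₂) :
    ∃ ν : ℝ, 0 < ν ∧ ν < 2 * s₂ - 1 ∧ IsOfType ρ ν := by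
  have hlt : minimalTypeIndex ρ < ENNReal.ofReal (2 * s₂ - 1) := by
    have hne : minimalTypeIndex ρ ≠ ⊤ := (hν.trans_le le_top).ne
    lift minimalTypeIndex ρ to ℝ≥0 using hne with μ
    have e : (1 : ℝ≥0∞) / 2 + μ / 2 = ENNReal.ofReal (1 / 2 + μ / 2) := by
      rw [ENNReal.ofReal_add (by norm_num) (by positivity),
        ENNReal.ofReal_div_of_pos (by norm_num), ENNReal.ofReal_div_of_pos (by norm_num)]
      simp
    rw [e, ENNReal.ofReal_lt_ofReal_iff_of_nonneg (by positivity)] at h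
    rw [ENNReal.lt_ofReal_iff_toReal_lt (by simp)]
    simp only [ENNReal.coe_toReal]
    linarith
  unfold minimalTypeIndex at hlt
  split_ifs at hlt with hirr
  · obtain ⟨_, ⟨ν, ⟨h0, hT⟩, rfl⟩, hx⟩ := sInf_lt_iff.1 hlt
    refine ⟨ν, h0, ?_, hT⟩
    exact (ENNReal.ofReal_lt_ofReal_iff_of_nonneg h0.le).1 hx
  · simp at hlt

/-- The frequencies `m` for which the interaction `(m, n - m) → n` may be nearly resonant: `m` or
`n - m` is the integer nearest to `c n`. -/
def nearResonant (c : ℝ) (n : ℤ) : Finset ℤ := {round (c * n), n - round (c * n)}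

/-- An integer within `1 / 2` of `x` is the nearest one, so that each resonant line carries at most
one nearly resonant frequency. -/
lemma eq_round_of_abs_sub_lt {x : ℝ} {m : ℤ} (h : |(m : ℝ) - x| < 1 / 2) : m = round x := by
  have h2 := abs_sub_round x
  have : |((m - round x : ℤ) : ℝ)| < 1 := by
    push_cast
    calc |(m : ℝ) - round x| ≤ |(m : ℝ) - x| + |x - round x| := abs_sub_le _ _ _
      _ < 1 := by linarith
  rw [← Int.cast_abs] at this
  have h3 : |m - round x| < 1 := by exact_mod_cast this
  have := Int.abs_lt_one_iff.1 h3
  omega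

/-- A number of type `ν` keeps its multiples `c n` away from the integers. -/
lemma le_abs_sub_of_isOfType {c ν K : ℝ}
    (hT : ∀ m n : ℤ, n ≠ 0 → K / |(n : ℝ)| ^ (2 + ν) ≤ |c - (m : ℝ) / (n : ℝ)|)
    (m n : ℤ) (hn : n ≠ 0) : K * |(n : ℝ)| ^ (-1 - ν) ≤ |(m : ℝ) - c * n| := by
  have hn' : (n : ℝ) ≠ 0 := by exact_mod_cast hn
  have hN : 0 < |(n : ℝ)| := abs_pos.2 hn'
  have h := mul_le_mul_of_nonneg_right (hT m n hn) hN.le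
  rw [← abs_mul, sub_mul, div_mul_cancel₀ _ hn', abs_sub_comm] at h
  refine le_trans (le_of_eq ?_) h
  rw [div_mul_eq_mul_div, mul_div_assoc]
  congr 1
  rw [show (-1 - ν : ℝ) = 1 - (2 + ν) by ring, Real.rpow_sub hN, Real.rpow_one]

/-- Of the two distances `d`, `e` to the resonant lines, the larger is comparable to `N`, and only the
smaller one needs the Diophantine lower bound. -/
lemma rpow_neg_le_mul_of_max {N κ K ν d e : ℝ} (hN : 1 ≤ N) (hκ : 0 < κ) (hK : 0 < K)
    (hd : K * N ^ (-1 - ν) ≤ d) (he : K * N ^ (-1 - ν) ≤ e) (hde : κ * N ≤ d + e) :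
    κ * K / 2 * N ^ (-ν) ≤ d * e := by
  have hN0 : 0 < N := by linarith
  have hp : 0 ≤ K * N ^ (-1 - ν) := by positivity
  have key : κ * K / 2 * N ^ (-ν) = (κ * N / 2) * (K * N ^ (-1 - ν)) := by
    rw [show (-ν : ℝ) = 1 + (-1 - ν) by ring, Real.rpow_add hN0, Real.rpow_one]; ring
  rw [key]
  rcases le_total d e with h | h
  · rw [mul_comm]
    exact mul_le_mul hd (by linarith) (by positivity) (hp.trans hd)
  · exact mul_le_mul (by linarith) he hp (by nlinarith [hp.trans he])

set_option maxHeartbeats 400000 in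
/-- The arithmetic estimate behind the bilinear bound: away from the two nearly resonant
interactions the weight with derivative is controlled by the resonance function and the `s₁`
brackets, and on them by the resonance function and the `s₂` brackets. -/
lemma exists_weight_le (α s₁ s₂ c ν : ℝ) (hα : 0 < α)
    (hc : 1 / 2 ≤ c) (hν : ν < 2 * s₂ - 1) (hT : IsOfType c ν)
    (h2 : s₁ < 1 / 2) (h3 : 1 / 2 < s₂) (h4 : s₂ < 1) (h5 : s₂ < 2 * s₁) :
    ∃ C : ℝ, 0 < C ∧ ∀ n m : ℤ,
      |(n : ℝ)| * jb n ^ s₂ ≤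
        C * jb (3 * α * n * ((m - c * n) * (((n - m : ℤ) : ℝ) - c * n))) ^ (1 / 2 : ℝ) *
          (jb m ^ s₁ * jb (n - m : ℤ) ^ s₁ +
            if m ∈ nearResonant c n then jb m ^ s₂ * jb (n - m : ℤ) ^ s₂ else 0) := by
  obtain ⟨K, hK, hT⟩ := hT
  have hc2 : 0 < 2 * c - 1 := by
    have := (div_pos hK (by positivity)).trans_le (hT 1 2 (by norm_num))
    rcases eq_or_lt_of_le hc with h | h
    · rw [← h] at this; norm_num at this
    · linarith
  have hc1 : 0 < |1 - c| := by
    have := (div_pos hK (by positivity)).trans_le (hT 1 1 (by norm_num))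
    rw [abs_sub_comm]
    simpa using this
  set κ := 2 * c - 1 with hκ
  set δ := min (1 / 4) (|1 - c| / 2)
  have hδ0 : 0 < δ := lt_min (by norm_num) (by positivity)
  have hδ1 : δ ≤ 1 / 4 := min_le_left _ _
  have hδ2 : δ ≤ |1 - c| / 2 := min_le_right _ _
  -- one constant for each of: one input frequency small, both inputs large, nearly resonant
  set Ca := 2 / (√(3 * α * (δ / 4)) * (1 / 2))
  set Cb := 2 / (√(3 * α * (κ / 4)) * (δ * δ))
  set Cr := 2 / (√(3 * α * (κ * K / 2)) * (δ / 2))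
  have hCa0 : 0 < Ca := by positivity
  have hCb0 : 0 < Cb := by positivity
  have hCr0 : 0 < Cr := by positivity
  refine ⟨Ca + Cb + Cr, by positivity, fun n m => ?_⟩
  -- for `n = 0` the derivative makes the left side vanish
  rcases eq_or_ne n 0 with rfl | hn
  · have := jb_pos (m : ℝ)
    have := jb_pos ((0 - m : ℤ) : ℝ)
    have := jb_pos (3 * α * (0 : ℤ) * ((m - c * (0 : ℤ)) * (((0 - m : ℤ) : ℝ) - c * (0 : ℤ))))
    simp only [Int.cast_zero, abs_zero, zero_mul] at this ⊢
    split_ifs <;> positivity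
  set x : ℝ := (m : ℝ) with hx
  set y : ℝ := ((n - m : ℤ) : ℝ) with hy
  have hxy : x + y = n := by rw [hx, hy]; push_cast; ring
  set N : ℝ := |(n : ℝ)| with hNdef
  have hN : 1 ≤ N := by
    rw [hNdef, ← Int.cast_abs]; exact_mod_cast Int.one_le_abs hn
  have hN0 : 0 < N := by linarith
  have hX := jb_pos x
  have hY := jb_pos y
  set d := |x - c * n|
  set e := |y - c * n|
  have hjb : jb (3 * α * n * ((x - c * n) * (y - c * n))) = 1 + 3 * α * N * (d * e) := by
    rw [jb, abs_mul, abs_mul (3 * α), abs_mul (x - c * n),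
      abs_of_pos (show 0 < 3 * α by positivity)]
  have hcN : |c * n| = c * N := by rw [abs_mul, abs_of_nonneg (by linarith)]
  have hc1N : |(1 - c) * n| = |1 - c| * N := abs_mul _ _
  have hde : κ * N ≤ d + e := by
    have h := abs_add_le (x - c * n) (y - c * n)
    have e1 : x - c * n + (y - c * n) = -(κ * n) := by rw [hκ]; linear_combination hxy
    rw [e1, abs_neg, abs_mul, abs_of_pos hc2] at h
    exact h
  have hdK : K * N ^ (-1 - ν) ≤ d := le_abs_sub_of_isOfType hT m n hn
  have heK : K * N ^ (-1 - ν) ≤ e := le_abs_sub_of_isOfType hT (n - m) n hn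
  have hd0 : 0 ≤ d := abs_nonneg _
  have he0 : 0 ≤ e := abs_nonneg _
  -- triangle inequalities relating the two inputs and the distances to the resonances
  have tx : c * N ≤ d + |x| := by
    have h := abs_sub_abs_le_abs_sub (c * n) x
    rw [abs_sub_comm, hcN] at h; linarith
  have ty : c * N ≤ e + |y| := by
    have h := abs_sub_abs_le_abs_sub (c * n) y
    rw [abs_sub_comm, hcN] at h; linarith
  have tdx : |1 - c| * N ≤ e + |x| := by
    have h := abs_add_le (y - c * n) x
    rw [show y - c * n + x = (1 - c) * n by linear_combination hxy, hc1N] at h; exact h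
  have tdy : |1 - c| * N ≤ d + |y| := by
    have h := abs_add_le (x - c * n) y
    rw [show x - c * n + y = (1 - c) * n by linear_combination hxy, hc1N] at h; exact h
  have txy : N ≤ |x| + |y| := by
    rw [hNdef, ← hxy]; exact abs_add_le _ _
  rw [hjb, show jb (n : ℝ) = 1 + N from rfl]
  have hH : 0 ≤ (1 + 3 * α * N * (d * e)) ^ (1 / 2 : ℝ) := by positivity
  have hs1 : 0 ≤ jb x ^ s₁ * jb y ^ s₁ := by positivity
  have hs2 : 0 ≤ jb x ^ s₂ * jb y ^ s₂ := by positivity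
  -- the common last step: any of the three constants and any of the two weights suffices
  have fin : ∀ C w : ℝ, 0 ≤ C → C ≤ Ca + Cb + Cr → 0 ≤ w →
      (w ≤ jb x ^ s₁ * jb y ^ s₁ +
        if m ∈ nearResonant c n then jb x ^ s₂ * jb y ^ s₂ else 0) →
      N * (1 + N) ^ s₂ ≤ C * (1 + 3 * α * N * (d * e)) ^ (1 / 2 : ℝ) * w →
      N * (1 + N) ^ s₂ ≤ (Ca + Cb + Cr) * (1 + 3 * α * N * (d * e)) ^ (1 / 2 : ℝ) *
        (jb x ^ s₁ * jb y ^ s₁ +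
          if m ∈ nearResonant c n then jb x ^ s₂ * jb y ^ s₂ else 0) := by
    intro C w hC0 hC hw hle h
    exact h.trans (mul_le_mul (mul_le_mul_of_nonneg_right hC hH) hle hw (by positivity))
  have hw1 : jb x ^ s₁ * jb y ^ s₁ ≤ jb x ^ s₁ * jb y ^ s₁ +
      if m ∈ nearResonant c n then jb x ^ s₂ * jb y ^ s₂ else 0 := by
    split_ifs <;> linarith
  by_cases hres : m ∈ nearResonant c n ∧ (d < 1 / 2 ∨ e < 1 / 2)
  · refine fin Cr (jb x ^ s₂ * jb y ^ s₂) hCr0.le (by linarith) hs2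
      (by rw [if_pos hres.1]; linarith) ?_
    refine weight_le_of_exponents (p := 1 - ν) (q := 2) hN (by positivity) (by positivity)
      (by linarith) (by linarith) h4.le (by linarith) h4.le hX hY ?_ ?_ (by linarith)
    · have := rpow_neg_le_mul_of_max hN hc2 hK hdK heK hde
      calc 3 * α * (κ * K / 2) * N ^ (1 - ν) = 3 * α * N * (κ * K / 2 * N ^ (-ν)) := by
            rw [sub_eq_add_neg, Real.rpow_add hN0, Real.rpow_one]; ring
        _ ≤ _ := by gcongr
    · rw [Real.rpow_two]
      have a1 : δ * N ≤ |1 - c| * N := by gcongr; linarith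
      have a2 : N / 2 ≤ c * N := by linarith [mul_le_mul_of_nonneg_right hc hN0.le]
      rcases hres.2 with h | h
      · have b1 : N / 2 ≤ jb x := by unfold jb; linarith
        have b2 : δ * N ≤ jb y := by unfold jb; linarith
        calc δ / 2 * N ^ 2 = (N / 2) * (δ * N) := by ring
          _ ≤ _ := by gcongr
      · have b1 : N / 2 ≤ jb y := by unfold jb; linarith
        have b2 : δ * N ≤ jb x := by unfold jb; linarith
        calc δ / 2 * N ^ 2 = (δ * N) * (N / 2) := by ring
          _ ≤ _ := by gcongr
  · have hdh : 1 / 2 ≤ d ∧ 1 / 2 ≤ e := by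
      by_contra hcon
      have hor : d < 1 / 2 ∨ e < 1 / 2 := by
        by_contra! h'; exact hcon h'
      refine hres ⟨?_, hor⟩
      rcases hor with h | h
      · simp [nearResonant, ← eq_round_of_abs_sub_lt h]
      · simp [nearResonant, ← eq_round_of_abs_sub_lt h]
    have a0 : 2 * δ * N ≤ |1 - c| * N := by gcongr; linarith
    have a2 : N / 2 ≤ c * N := by linarith [mul_le_mul_of_nonneg_right hc hN0.le]
    have a3 : δ * N ≤ N / 4 := by linarith [mul_le_mul_of_nonneg_right hδ1 hN0.le]
    by_cases hsx : jb x < δ * N ∨ jb y < δ * N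
    · have hde2 : δ / 4 * N ^ 2 ≤ d * e := by
        rcases hsx with h | h
        · have : |x| ≤ δ * N := by unfold jb at h; linarith
          calc δ / 4 * N ^ 2 = (N / 4) * (δ * N) := by ring
            _ ≤ _ := by gcongr <;> linarith
        · have : |y| ≤ δ * N := by unfold jb at h; linarith
          calc δ / 4 * N ^ 2 = (δ * N) * (N / 4) := by ring
            _ ≤ _ := by gcongr <;> linarith
      have hXY : 1 / 2 * N ≤ jb x * jb y := by
        have g1 := one_le_jb x
        have g2 := one_le_jb y
        rcases hsx with h | h
        · have : 1 / 2 * N ≤ jb y := by unfold jb at h ⊢; linarith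
          linarith [mul_le_mul_of_nonneg_right g1 hY.le]
        · have : 1 / 2 * N ≤ jb x := by unfold jb at h ⊢; linarith
          linarith [mul_le_mul_of_nonneg_left g2 hX.le]
      refine fin Ca _ hCa0.le (by linarith) hs1 hw1 ?_
      refine weight_le_of_exponents (p := 3) (q := 1) hN (by positivity) (by positivity)
        (by norm_num) (by linarith) (by linarith) (by linarith) h4.le hX hY ?_ ?_ (by linarith)
      · calc 3 * α * (δ / 4) * N ^ (3 : ℝ) = 3 * α * N * (δ / 4 * N ^ 2) := by
              rw [show (3 : ℝ) = ((3 : ℕ) : ℝ) by norm_num, Real.rpow_natCast]; push_cast; ring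
          _ ≤ _ := by gcongr
      · rw [Real.rpow_one]; exact hXY
    · push Not at hsx
      refine fin Cb _ hCb0.le (by linarith) hs1 hw1 ?_
      refine weight_le_of_exponents (p := 2) (q := 2) hN (by positivity) (by positivity)
        (mul_le_one₀ (by linarith) hδ0.le (by linarith)) (by linarith) (by linarith) (by linarith)
        h4.le hX hY ?_ ?_ (by linarith)
      · have : κ / 4 * N ≤ d * e := by
          rcases le_total d e with h | h
          · linarith [mul_le_mul_of_nonneg_right hdh.1 he0]
          · linarith [mul_le_mul_of_nonneg_left hdh.2 hd0]
        calc 3 * α * (κ / 4) * N ^ (2 : ℝ) = 3 * α * N * (κ / 4 * N) := by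
              rw [Real.rpow_two]; ring
          _ ≤ _ := by gcongr
      · rw [Real.rpow_two]
        calc δ * δ * N ^ 2 = (δ * N) * (δ * N) := by ring
          _ ≤ _ := mul_le_mul hsx.1 hsx.2 (by positivity) hX.le

/-! ### Convolutions of nonnegative functions on the line -/

/-- The convolution `∫ F(y) G(τ - y) dy` of nonnegative functions on the line. -/
def lconv (F G : ℝ → ℝ≥0∞) (τ : ℝ) : ℝ≥0∞ := ∫⁻ y, F y * G (τ - y)

lemma lconv_comm (F G : ℝ → ℝ≥0∞) : lconv F G = lconv G F := by
  ext τ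
  unfold lconv
  rw [← lintegral_sub_left_eq_self (fun y => F y * G (τ - y)) τ]
  simp only [sub_sub_cancel, mul_comm]

lemma measurable_lconv {F G : ℝ → ℝ≥0∞} (hF : Measurable F) (hG : Measurable G) :
    Measurable (lconv F G) := by
  refine Measurable.lintegral_prod_right' (f := fun p : ℝ × ℝ => F p.2 * G (p.1 - p.2)) ?_
  fun_prop

lemma lintegral_lconv {F G : ℝ → ℝ≥0∞} (hF : Measurable F) (hG : Measurable G) :
    ∫⁻ τ, lconv F G τ = (∫⁻ τ, F τ) * ∫⁻ τ, G τ := by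
  unfold lconv
  rw [lintegral_lintegral_swap (by fun_prop)]
  have : ∀ y, ∫⁻ τ, F y * G (τ - y) = F y * ∫⁻ τ, G τ := fun y => by
    rw [lintegral_const_mul _ (by fun_prop), lintegral_sub_right_eq_self G y]
  simp_rw [this]
  rw [lintegral_mul_const _ hF]

lemma eLpNorm_two_sq {Ω : Type*} [MeasurableSpace Ω] {μ : Measure Ω} {F : Ω → ℝ≥0∞} :
    eLpNorm F 2 μ ^ 2 = ∫⁻ τ, F τ ^ 2 ∂μ := by
  rw [eLpNorm_eq_lintegral_rpow_enorm_toReal (by norm_num) (by norm_num), ← ENNReal.rpow_natCast,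
    ← ENNReal.rpow_mul]
  simp

/-- Young's inequality `L¹ * L² → L²`. -/
lemma eLpNorm_lconv_le {F G : ℝ → ℝ≥0∞} (hF : Measurable F) (hG : Measurable G) :
    eLpNorm (lconv F G) 2 volume ≤ (∫⁻ τ, F τ) * eLpNorm G 2 volume := by
  rw [← ENNReal.pow_le_pow_left_iff (n := 2) (by norm_num), mul_pow, eLpNorm_two_sq, eLpNorm_two_sq]
  -- Cauchy-Schwarz with respect to the measure with density `F`
  have cs : ∀ τ, lconv F G τ ^ 2 ≤ (∫⁻ y, F y) * lconv F (fun y => G y ^ 2) τ := by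
    intro τ
    have h := ENNReal.lintegral_mul_le_Lp_mul_Lq volume Real.HolderConjugate.two_two
      (f := fun y => F y ^ (1 / 2 : ℝ)) (g := fun y => F y ^ (1 / 2 : ℝ) * G (τ - y))
      (by fun_prop) (by fun_prop)
    have e1 : ∀ y, F y ^ (1 / 2 : ℝ) * (F y ^ (1 / 2 : ℝ) * G (τ - y)) = F y * G (τ - y) := by
      intro y
      rw [← mul_assoc, ← ENNReal.rpow_add_of_nonneg _ _ (by norm_num) (by norm_num)]
      norm_num
    have e2 : ∀ y, (F y ^ (1 / 2 : ℝ)) ^ (2 : ℝ) = F y := by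
      intro y; rw [← ENNReal.rpow_mul]; norm_num
    have e3 : ∀ y, (F y ^ (1 / 2 : ℝ) * G (τ - y)) ^ (2 : ℝ) = F y * G (τ - y) ^ 2 := by
      intro y
      rw [ENNReal.mul_rpow_of_nonneg _ _ (by norm_num), e2]
      norm_num
    simp only [Pi.mul_apply, e1, e2, e3] at h
    have h2 := pow_le_pow_left₀ zero_le h 2
    have e4 : ∀ z : ℝ≥0∞, (z ^ (1 / 2 : ℝ)) ^ 2 = z := by
      intro z; rw [← ENNReal.rpow_natCast, ← ENNReal.rpow_mul]; norm_num
    rw [mul_pow, e4, e4] at h2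
    exact h2
  calc ∫⁻ τ, lconv F G τ ^ 2 ≤ ∫⁻ τ, (∫⁻ y, F y) * lconv F (fun y => G y ^ 2) τ :=
        lintegral_mono cs
    _ = (∫⁻ τ, F τ) ^ 2 * ∫⁻ τ, G τ ^ 2 := by
        rw [lintegral_const_mul _ (measurable_lconv hF (by fun_prop)),
          lintegral_lconv hF (by fun_prop)]
        ring

/-- Minkowski's inequality in `L²` for a countable sum. -/
lemma eLpNorm_tsum_le {ι : Type*} [Countable ι] {F : ι → ℝ → ℝ≥0∞} (hF : ∀ i, Measurable (F i)) :
    eLpNorm (fun τ => ∑' i, F i τ) 2 volume ≤ ∑' i, eLpNorm (F i) 2 volume := by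
  classical
  rw [← ENNReal.pow_le_pow_left_iff (n := 2) (by norm_num), eLpNorm_two_sq]
  have h1 : ∀ τ, (∑' i, F i τ) ^ 2 = ⨆ s : Finset ι, (∑ i ∈ s, F i τ) ^ 2 := by
    intro τ
    rw [ENNReal.tsum_eq_iSup_sum]
    have := (ENNReal.orderIsoRpow 2 (by norm_num)).map_iSup (fun s : Finset ι => ∑ i ∈ s, F i τ)
    simpa only [ENNReal.orderIsoRpow_apply, ENNReal.rpow_two] using this
  simp_rw [h1]
  rw [lintegral_iSup_directed (fun s => by fun_prop)]
  · refine iSup_le fun s => ?_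
    have e : ∫⁻ τ, (∑ i ∈ s, F i τ) ^ 2 = eLpNorm (∑ i ∈ s, F i) 2 volume ^ 2 := by
      rw [eLpNorm_two_sq]; simp
    rw [e]
    refine pow_le_pow_left₀ zero_le ?_ 2
    refine (eLpNorm_sum_le (fun i _ => (hF i).aestronglyMeasurable) (by norm_num)).trans ?_
    exact ENNReal.sum_le_tsum s
  · intro s t
    refine ⟨s ∪ t, fun τ => ?_, fun τ => ?_⟩
    · exact pow_le_pow_left₀ zero_le (Finset.sum_le_sum_of_subset Finset.subset_union_left) 2
    · exact pow_le_pow_left₀ zero_le (Finset.sum_le_sum_of_subset Finset.subset_union_right) 2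

/-- Hölder's inequality for the product of two `L²` functions. -/
lemma lintegral_mul_le_eLpNorm_two {Ω : Type*} [MeasurableSpace Ω] {μ : Measure Ω}
    {F G : Ω → ℝ≥0∞} (hF : Measurable F) (hG : Measurable G) :
    ∫⁻ τ, F τ * G τ ∂μ ≤ eLpNorm F 2 μ * eLpNorm G 2 μ := by
  have h := ENNReal.lintegral_mul_le_Lp_mul_Lq μ Real.HolderConjugate.two_two
    hF.aemeasurable hG.aemeasurable
  rw [eLpNorm_eq_lintegral_rpow_enorm_toReal (by norm_num) (by norm_num),
    eLpNorm_eq_lintegral_rpow_enorm_toReal (by norm_num) (by norm_num)]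
  simpa using h

/-! ### The estimate for one pair of frequencies -/

/-- The weight `⟨τ - a⟩ ^ b`, valued in `[0, ∞]`. -/
def modWeight (a b : ℝ) (τ : ℝ) : ℝ≥0∞ := ENNReal.ofReal (jb (τ - a) ^ b)

lemma measurable_jb : Measurable jb := by unfold jb; fun_prop

@[fun_prop]
lemma measurable_modWeight (a b : ℝ) : Measurable (modWeight a b) := by
  unfold modWeight
  have := measurable_jb
  fun_prop

/-- The quantity `‖⟨τ - a⟩^{1/2} F‖_{L²} + ‖F‖_{L¹}` attached to one Fourier mode. -/
def modeNorm (a : ℝ) (F : ℝ → ℝ≥0∞) : ℝ≥0∞ :=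
  eLpNorm (fun τ => modWeight a (1 / 2) τ * F τ) 2 volume + ∫⁻ τ, F τ

lemma eLpNorm_two_le_modeNorm (a : ℝ) (F : ℝ → ℝ≥0∞) : eLpNorm F 2 volume ≤ modeNorm a F := by
  refine le_trans ?_ (le_add_right le_rfl)
  refine eLpNorm_mono_enorm fun τ => ?_
  simp only [enorm_eq_self]
  refine le_mul_of_one_le_left zero_le ?_
  rw [modWeight, ENNReal.one_le_ofReal]
  exact Real.one_le_rpow (one_le_jb _) (by norm_num)

lemma modWeight_le_one (a : ℝ) {b : ℝ} (hb : b ≤ 0) (τ : ℝ) : modWeight a b τ ≤ 1 := by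
  rw [modWeight, ENNReal.ofReal_le_one]
  exact Real.rpow_le_one_of_one_le_of_nonpos (one_le_jb _) hb

lemma modWeight_mul (a b b' : ℝ) (τ : ℝ) :
    modWeight a b τ * modWeight a b' τ = modWeight a (b + b') τ := by
  unfold modWeight
  rw [← ENNReal.ofReal_mul (jb_rpow_nonneg _ _), ← Real.rpow_add (jb_pos _)]

/-- A large resonance function forces one of the three modulations to be large. -/
lemma resonance_mul_lconv_le {F G : ℝ → ℝ≥0∞} (hF : Measurable F) (hG : Measurable G)
    (a₀ a₁ a₂ τ : ℝ) :
    ENNReal.ofReal (jb (a₀ - a₁ - a₂) ^ (1 / 2 : ℝ)) * lconv F G τ ≤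
      modWeight a₀ (1 / 2) τ * lconv F G τ +
        (lconv (fun y => modWeight a₁ (1 / 2) y * F y) G τ +
          lconv F (fun y => modWeight a₂ (1 / 2) y * G y) τ) := by
  unfold lconv
  rw [← lintegral_const_mul _ (by fun_prop), ← lintegral_const_mul _ (by fun_prop),
    ← lintegral_add_left (by fun_prop), ← lintegral_add_left (by fun_prop)]
  refine lintegral_mono fun y => ?_
  have h : ENNReal.ofReal (jb (a₀ - a₁ - a₂) ^ (1 / 2 : ℝ)) ≤
      modWeight a₀ (1 / 2) τ + modWeight a₁ (1 / 2) y + modWeight a₂ (1 / 2) (τ - y) := by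
    have h0 : ∀ x, 0 ≤ jb x ^ (1 / 2 : ℝ) := fun x => jb_rpow_nonneg x _
    unfold modWeight
    rw [← ENNReal.ofReal_add (h0 _) (h0 _), ← ENNReal.ofReal_add (add_nonneg (h0 _) (h0 _)) (h0 _)]
    refine ENNReal.ofReal_le_ofReal ?_
    have key := sqrt_jb_add_le (-(τ - a₀)) (y - a₁) (τ - y - a₂)
    have en : jb (-(τ - a₀)) = jb (τ - a₀) := by unfold jb; rw [abs_neg]
    rw [en] at key
    convert! key using 2
    congr 1
    ring
  calc _ ≤ (modWeight a₀ (1 / 2) τ + modWeight a₁ (1 / 2) y + modWeight a₂ (1 / 2) (τ - y)) *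
        (F y * G (τ - y)) := by gcongr
    _ = _ := by ring

/-- The `L²` norm of the weight `⟨τ⟩⁻¹`. -/
def weightConst : ℝ≥0∞ := eLpNorm (modWeight 0 (-1)) 2 volume

lemma eLpNorm_modWeight (a : ℝ) : eLpNorm (modWeight a (-1)) 2 volume = weightConst := by
  have h : modWeight a (-1) = modWeight 0 (-1) ∘ fun τ => τ - a := by
    ext τ; simp [modWeight]
  rw [h, eLpNorm_comp_measurePreserving (measurable_modWeight 0 (-1)).aestronglyMeasurable
    (measurePreserving_sub_right volume a), weightConst]

lemma weightConst_lt_top : weightConst < ∞ := by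
  have h := finite_integral_one_add_norm (E := ℝ) (μ := volume) (r := 2) (by simp)
  have e : weightConst ^ 2 < ∞ := by
    rw [weightConst, eLpNorm_two_sq]
    refine lt_of_eq_of_lt ?_ h
    refine lintegral_congr fun τ => ?_
    rw [modWeight, ← ENNReal.ofReal_pow (jb_rpow_nonneg _ _), ← Real.rpow_natCast,
      ← Real.rpow_mul (jb_pos _).le]
    simp [jb]
  by_contra hcon
  simp [not_lt_top_iff.1 hcon] at e

/-- The part of the convolution in which an input has the large modulation lies in `L²`. -/
lemma eLpNorm_inputs_le {F G : ℝ → ℝ≥0∞} (hF : Measurable F) (hG : Measurable G)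
    (a₁ a₂ : ℝ) :
    eLpNorm (fun τ => lconv (fun y => modWeight a₁ (1 / 2) y * F y) G τ +
      lconv F (fun y => modWeight a₂ (1 / 2) y * G y) τ) 2 volume ≤
      2 * (modeNorm a₁ F * modeNorm a₂ G) := by
  have m1 : Measurable (lconv (fun y => modWeight a₁ (1 / 2) y * F y) G) :=
    measurable_lconv (by fun_prop) hG
  have m2 : Measurable (lconv F (fun y => modWeight a₂ (1 / 2) y * G y)) :=
    measurable_lconv hF (by fun_prop)
  refine (eLpNorm_add_le m1.aestronglyMeasurable m2.aestronglyMeasurable (by norm_num)).trans ?_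
  rw [two_mul]
  refine add_le_add ?_ ?_
  · rw [lconv_comm, mul_comm]
    refine (eLpNorm_lconv_le hG (by fun_prop)).trans ?_
    unfold modeNorm
    gcongr
    · exact le_add_left le_rfl
    · exact le_add_right le_rfl
  · refine (eLpNorm_lconv_le hF (by fun_prop)).trans ?_
    unfold modeNorm
    gcongr
    · exact le_add_left le_rfl
    · exact le_add_right le_rfl

/-- One interaction in the `L²_τ` part of the `Z` norm, with a gain of the square root of the
resonance function. -/
lemma resonance_mul_eLpNorm_le {F G : ℝ → ℝ≥0∞} (hF : Measurable F) (hG : Measurable G)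
    (a₀ a₁ a₂ : ℝ) :
    ENNReal.ofReal (jb (a₀ - a₁ - a₂) ^ (1 / 2 : ℝ)) *
        eLpNorm (fun τ => modWeight a₀ (-1 / 2) τ * lconv F G τ) 2 volume ≤
      3 * (modeNorm a₁ F * modeNorm a₂ G) := by
  have mc := measurable_lconv hF hG
  set R := ENNReal.ofReal (jb (a₀ - a₁ - a₂) ^ (1 / 2 : ℝ))
  set I : ℝ → ℝ≥0∞ := fun τ => lconv (fun y => modWeight a₁ (1 / 2) y * F y) G τ +
      lconv F (fun y => modWeight a₂ (1 / 2) y * G y) τ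
  have mI : Measurable I :=
    (measurable_lconv (by fun_prop) hG).add (measurable_lconv hF (by fun_prop))
  have hR : R * eLpNorm (fun τ => modWeight a₀ (-1 / 2) τ * lconv F G τ) 2 volume ≤
      eLpNorm (fun τ => R * (modWeight a₀ (-1 / 2) τ * lconv F G τ)) 2 volume := by
    rw [← ENNReal.pow_le_pow_left_iff (n := 2) (by norm_num), mul_pow, eLpNorm_two_sq, eLpNorm_two_sq,
      ← lintegral_const_mul _ (by fun_prop)]
    simp_rw [mul_pow]
    exact le_rfl
  refine hR.trans ?_
  calc _ ≤ eLpNorm (fun τ => lconv F G τ + I τ) 2 volume := by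
        refine eLpNorm_mono_enorm fun τ => ?_
        simp only [enorm_eq_self]
        calc R * (modWeight a₀ (-1 / 2) τ * lconv F G τ)
            = modWeight a₀ (-1 / 2) τ * (R * lconv F G τ) := by ring
          _ ≤ modWeight a₀ (-1 / 2) τ * (modWeight a₀ (1 / 2) τ * lconv F G τ + I τ) := by
              gcongr; exact resonance_mul_lconv_le hF hG a₀ a₁ a₂ τ
          _ = modWeight a₀ 0 τ * lconv F G τ + modWeight a₀ (-1 / 2) τ * I τ := by
              rw [mul_add, ← mul_assoc, modWeight_mul]; norm_num
          _ ≤ 1 * lconv F G τ + 1 * I τ := by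
              gcongr
              · exact modWeight_le_one _ le_rfl _
              · exact modWeight_le_one _ (by norm_num) _
          _ = _ := by simp
    _ ≤ eLpNorm (lconv F G) 2 volume + eLpNorm I 2 volume :=
        eLpNorm_add_le mc.aestronglyMeasurable mI.aestronglyMeasurable (by norm_num)
    _ ≤ modeNorm a₁ F * modeNorm a₂ G + 2 * (modeNorm a₁ F * modeNorm a₂ G) := by
        gcongr
        · refine (eLpNorm_lconv_le hF hG).trans ?_
          gcongr
          · exact le_add_left le_rfl
          · exact eLpNorm_two_le_modeNorm _ _
        · exact eLpNorm_inputs_le hF hG a₁ a₂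
    _ = _ := by ring

/-- One interaction in the `L¹_τ` part of the `Z` norm. When an input has the large modulation, the
`L¹` norm is reduced to the `L²` norm through the square integrability of `⟨τ⟩⁻¹`. -/
lemma resonance_mul_lintegral_le {F G : ℝ → ℝ≥0∞} (hF : Measurable F) (hG : Measurable G)
    (a₀ a₁ a₂ : ℝ) :
    ENNReal.ofReal (jb (a₀ - a₁ - a₂) ^ (1 / 2 : ℝ)) *
        ∫⁻ τ, modWeight a₀ (-1) τ * lconv F G τ ≤
      (1 + 2 * weightConst) * (modeNorm a₁ F * modeNorm a₂ G) := by
  have mc := measurable_lconv hF hG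
  set R := ENNReal.ofReal (jb (a₀ - a₁ - a₂) ^ (1 / 2 : ℝ))
  set I : ℝ → ℝ≥0∞ := fun τ => lconv (fun y => modWeight a₁ (1 / 2) y * F y) G τ +
      lconv F (fun y => modWeight a₂ (1 / 2) y * G y) τ
  have mI : Measurable I :=
    (measurable_lconv (by fun_prop) hG).add (measurable_lconv hF (by fun_prop))
  rw [← lintegral_const_mul _ (by fun_prop)]
  calc _ ≤ ∫⁻ τ, (lconv F G τ + modWeight a₀ (-1) τ * I τ) := by
        refine lintegral_mono fun τ => ?_
        calc R * (modWeight a₀ (-1) τ * lconv F G τ)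
            = modWeight a₀ (-1) τ * (R * lconv F G τ) := by ring
          _ ≤ modWeight a₀ (-1) τ * (modWeight a₀ (1 / 2) τ * lconv F G τ + I τ) := by
              gcongr; exact resonance_mul_lconv_le hF hG a₀ a₁ a₂ τ
          _ = modWeight a₀ (-1 / 2) τ * lconv F G τ + modWeight a₀ (-1) τ * I τ := by
              rw [mul_add, ← mul_assoc, modWeight_mul]; norm_num
          _ ≤ 1 * lconv F G τ + modWeight a₀ (-1) τ * I τ := by
              gcongr
              exact modWeight_le_one _ (by norm_num) _
          _ = _ := by simp
    _ = (∫⁻ τ, F τ) * (∫⁻ τ, G τ) + ∫⁻ τ, modWeight a₀ (-1) τ * I τ := by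
        rw [lintegral_add_left mc, lintegral_lconv hF hG]
    _ ≤ modeNorm a₁ F * modeNorm a₂ G + weightConst * (2 * (modeNorm a₁ F * modeNorm a₂ G)) := by
        gcongr
        · exact le_add_left le_rfl
        · exact le_add_left le_rfl
        · refine (lintegral_mul_le_eLpNorm_two (by fun_prop) mI).trans ?_
          rw [eLpNorm_modWeight]
          gcongr
          exact eLpNorm_inputs_le hF hG a₁ a₂
    _ = _ := by ring

/-! ### Fourier inversion in time -/

/-- The time factor `t ↦ ∫ e^{-i t τ} ψ(τ) dτ` of the test function `testFun n ψ`. -/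
def timeFactor (ψ : 𝓢(ℝ, ℂ)) (t : ℝ) : ℂ :=
  ∫ τ : ℝ, Complex.exp (-Complex.I * (t : ℂ) * (τ : ℂ)) * ψ τ

/-- The inverse Fourier transform `t ↦ (2π)⁻¹ ∫ e^{i t τ} f(τ) dτ` of an integrable function,
written with Mathlib's normalization of the Fourier transform. -/
def invFT (f : ℝ → ℂ) (t : ℝ) : ℂ :=
  ((2 * Real.pi : ℝ) : ℂ)⁻¹ * FourierTransform.fourier f (-(t / (2 * Real.pi)))

open FourierTransform

lemma timeFactor_eq (ψ : 𝓢(ℝ, ℂ)) (t : ℝ) : timeFactor ψ t = (𝓕 ψ) (t / (2 * Real.pi)) := by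
  rw [SchwartzMap.fourier_coe, Real.fourier_real_eq_integral_exp_smul, timeFactor]
  refine integral_congr_ae (Filter.Eventually.of_forall fun τ => ?_)
  simp only [smul_eq_mul]
  congr 2
  push_cast
  have : (Real.pi : ℂ) ≠ 0 := by exact_mod_cast Real.pi_ne_zero
  field_simp

/-- `timeFactor ψ` is itself a Schwartz function. -/
def timeFactorSchwartz (ψ : 𝓢(ℝ, ℂ)) : 𝓢(ℝ, ℂ) :=
  SchwartzMap.compCLMOfContinuousLinearEquiv ℂ
    (ContinuousLinearEquiv.smulLeft (R₁ := ℝ) (M₁ := ℝ)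
      (Units.mk0 (2 * Real.pi)⁻¹ (inv_ne_zero Real.two_pi_pos.ne'))) (𝓕 ψ)

lemma timeFactorSchwartz_apply (ψ : 𝓢(ℝ, ℂ)) : ⇑(timeFactorSchwartz ψ) = timeFactor ψ := by
  ext t
  rw [timeFactor_eq, timeFactorSchwartz]
  change (𝓕 ψ) ((2 * Real.pi)⁻¹ * t) = _
  rw [div_eq_inv_mul]

lemma integrable_timeFactor (ψ : 𝓢(ℝ, ℂ)) : Integrable (timeFactor ψ) := by
  rw [← timeFactorSchwartz_apply]; exact SchwartzMap.integrable _

lemma memLp_timeFactor (ψ : 𝓢(ℝ, ℂ)) : MemLp (timeFactor ψ) 2 volume := by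
  rw [← timeFactorSchwartz_apply]; exact SchwartzMap.memLp _ _ _

lemma continuous_timeFactor (ψ : 𝓢(ℝ, ℂ)) : Continuous (timeFactor ψ) := by
  rw [← timeFactorSchwartz_apply]; exact SchwartzMap.continuous _

lemma exists_timeFactor_eq (φ : 𝓢(ℝ, ℂ)) : ∃ ψ : 𝓢(ℝ, ℂ), timeFactor ψ = φ := by
  refine ⟨𝓕⁻ (SchwartzMap.compCLMOfContinuousLinearEquiv ℂ
    (ContinuousLinearEquiv.smulLeft (R₁ := ℝ) (M₁ := ℝ)
      (Units.mk0 (2 * Real.pi) Real.two_pi_pos.ne')) φ), ?_⟩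
  ext t
  rw [timeFactor_eq, FourierTransform.fourier_fourierInv_eq]
  change φ (2 * Real.pi * (t / (2 * Real.pi))) = φ t
  rw [mul_div_cancel₀ _ Real.two_pi_pos.ne']

lemma continuous_invFT {f : ℝ → ℂ} (hf : Integrable f) : Continuous (invFT f) := by
  have h : Continuous (𝓕 f) :=
    VectorFourier.fourierIntegral_continuous Real.continuous_fourierChar
      (by exact continuous_inner) hf
  unfold invFT
  exact continuous_const.mul (h.comp (by fun_prop))

lemma norm_invFT_le (f : ℝ → ℂ) (t : ℝ) : ‖invFT f t‖ ≤ ∫ τ, ‖f τ‖ := by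
  have h : ‖𝓕 f (-(t / (2 * Real.pi)))‖ ≤ ∫ τ, ‖f τ‖ :=
    VectorFourier.norm_fourierIntegral_le_integral_norm _ _ _ _ _
  rw [invFT, norm_mul, norm_inv, Complex.norm_real, Real.norm_of_nonneg Real.two_pi_pos.le]
  refine (mul_le_of_le_one_left (norm_nonneg _) (inv_le_one_of_one_le₀ ?_)).trans h
  linarith [Real.pi_gt_three]

/-- The inverse Fourier transform moves to the test function. -/
lemma integral_invFT_mul_timeFactor {f : ℝ → ℂ} (hf : Integrable f) (ψ : 𝓢(ℝ, ℂ)) :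
    ∫ t, invFT f t * timeFactor ψ t = ∫ τ, f τ * ψ τ := by
  have hpi := Real.two_pi_pos
  have e1 : ∀ t, invFT f t * timeFactor ψ t =
      (fun s => ((2 * Real.pi : ℝ) : ℂ)⁻¹ * (𝓕 f (-s) * (𝓕 ψ) s)) ((2 * Real.pi)⁻¹ * t) := by
    intro t
    simp only [invFT, timeFactor_eq, div_eq_inv_mul]
    ring
  rw [integral_congr_ae (Filter.Eventually.of_forall e1),
    Measure.integral_comp_mul_left
      (fun s => ((2 * Real.pi : ℝ) : ℂ)⁻¹ * (𝓕 f (-s) * (𝓕 ψ : 𝓢(ℝ, ℂ)) s)), inv_inv, abs_of_pos hpi, integral_const_mul,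
    Complex.real_smul, mul_inv_cancel_left₀ (by exact_mod_cast hpi.ne')]
  have e2 : ∀ s, 𝓕 f (-s) * (𝓕 ψ) s = (fun s => 𝓕 f s * (𝓕 ψ) (-s)) (-s) := by
    intro s; simp
  rw [integral_congr_ae (Filter.Eventually.of_forall e2), integral_neg_eq_self (fun s => 𝓕 f s * (𝓕 ψ : 𝓢(ℝ, ℂ)) (-s))]
  have e3 : ∀ s, (𝓕 ψ) (-s) = (𝓕⁻ ψ) s := by
    intro s
    rw [SchwartzMap.fourierInv_apply_eq]
    simp
  simp_rw [e3]
  have key := VectorFourier.integral_fourierIntegral_smul_eq_flip (L := innerₗ ℝ)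
    Real.continuous_fourierChar (by exact continuous_inner) hf (𝓕⁻ ψ).integrable
      (μ := volume) (ν := volume)
  simp only [smul_eq_mul] at key
  refine key.trans ?_
  have : VectorFourier.fourierIntegral Real.fourierChar volume (innerₗ ℝ).flip
      ⇑(𝓕⁻ ψ : 𝓢(ℝ, ℂ)) = ψ := by
    rw [flip_innerₗ]
    change ⇑(𝓕 (𝓕⁻ ψ : 𝓢(ℝ, ℂ)) : 𝓢(ℝ, ℂ)) = ψ
    rw [FourierTransform.fourier_fourierInv_eq]
  rw [this]

/-- Integration against the functions `timeFactor ψ` determines a function almost everywhere. -/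
lemma ae_eq_of_integral_mul_timeFactor {g g' : ℝ → ℂ} (hg : LocallyIntegrable g)
    (hg' : LocallyIntegrable g')
    (h : ∀ ψ, ∫ t, g t * timeFactor ψ t = ∫ t, g' t * timeFactor ψ t) :
    g =ᵐ[volume] g' := by
  refine ae_eq_of_integral_contDiff_smul_eq hg hg' fun φ hφ hφc => ?_
  have c1 : ContDiff ℝ ((⊤ : ℕ∞) : WithTop ℕ∞) (fun t => (φ t : ℂ)) :=
    Complex.ofRealCLM.contDiff.comp hφ
  have c2 : HasCompactSupport (fun t => (φ t : ℂ)) := hφc.comp_left (g := Complex.ofReal) rfl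
  obtain ⟨ψ, hψ⟩ := exists_timeFactor_eq (c2.toSchwartzMap c1)
  have := h ψ
  rw [hψ] at this
  simpa [mul_comm] using this

lemma invFT_mul_invFT {f g : ℝ → ℂ} (hf : Integrable f) (hg : Integrable g) (t : ℝ) :
    invFT f t * invFT g t = ((2 * Real.pi : ℝ) : ℂ)⁻¹ *
      invFT (convolution f g (ContinuousLinearMap.mul ℂ ℂ) volume) t := by
  simp only [invFT]
  rw [Real.fourier_mul_convolution_eq hf hg]
  ring

/-! ### Fourier series in space -/

lemma norm_fourier_apply (n : ℤ) (x : Circle2Pi) : ‖fourier n x‖ = 1 := by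
  rw [fourier_apply, Circle.norm_coe]

/-- Parseval's identity for the Fourier coefficients of a product of two square integrable
functions on the circle. -/
lemma hasSum_fourier_mul {f g : Circle2Pi → ℂ} (hf : MemLp f 2 volume) (hg : MemLp g 2 volume)
    (n : ℤ) :
    HasSum (fun m : ℤ => ((2 * Real.pi : ℝ) : ℂ)⁻¹ * ((∫ x, f x * fourier (-m) x) *
      ∫ x, g x * fourier (-(n - m)) x)) (∫ x, f x * g x * fourier (-n) x) := by
  have hpi : ((2 * Real.pi : ℝ) : ℂ) ≠ 0 := by exact_mod_cast Real.two_pi_pos.ne'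
  have hgh := hg.haarAddCircle
  have hfh := hf.haarAddCircle
  have hgn : MemLp (star fun x => g x * fourier (-n) x) 2 AddCircle.haarAddCircle := by
    refine MemLp.star (hgh.of_le_mul (c := 1)
      (hgh.1.mul (map_continuous (fourier (-n))).aestronglyMeasurable) ?_)
    exact Filter.Eventually.of_forall fun x => by rw [norm_mul, norm_fourier_apply]; simp
  have key := (fourierBasis (T := 2 * Real.pi)).hasSum_inner_mul_inner (hgn.toLp _) (hfh.toLp _)
  have e0 : inner ℂ (hgn.toLp _) (hfh.toLp _) =
      ((2 * Real.pi : ℝ) : ℂ)⁻¹ * ∫ x, f x * g x * fourier (-n) x := by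
    rw [L2.inner_def, ← Complex.ofReal_inv, ← Complex.real_smul, ← AddCircle.integral_haarAddCircle]
    refine integral_congr_ae ?_
    filter_upwards [hgn.coeFn_toLp, hfh.coeFn_toLp] with x h1 h2
    rw [h1, h2]
    simp only [RCLike.inner_apply, Pi.star_apply, RCLike.star_def, Complex.conj_conj]
    ring
  have e1 : ∀ m, inner ℂ (fourierBasis (T := 2 * Real.pi) m) (hfh.toLp _) =
      ((2 * Real.pi : ℝ) : ℂ)⁻¹ * ∫ x, f x * fourier (-m) x := by
    intro m
    rw [L2.inner_def, ← Complex.ofReal_inv, ← Complex.real_smul, ← AddCircle.integral_haarAddCircle,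
      coe_fourierBasis]
    refine integral_congr_ae ?_
    filter_upwards [coeFn_fourierLp 2 m, hfh.coeFn_toLp] with x h1 h2
    rw [h1, h2, _root_.fourier_neg, RCLike.inner_apply]
  have e2 : ∀ m, inner ℂ (hgn.toLp _) (fourierBasis (T := 2 * Real.pi) m) =
      ((2 * Real.pi : ℝ) : ℂ)⁻¹ * ∫ x, g x * fourier (-(n - m)) x := by
    intro m
    rw [L2.inner_def, ← Complex.ofReal_inv, ← Complex.real_smul, ← AddCircle.integral_haarAddCircle,
      coe_fourierBasis]
    refine integral_congr_ae ?_
    filter_upwards [coeFn_fourierLp 2 m, hgn.coeFn_toLp] with x h1 h2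
    rw [h1, h2, show -(n - m) = m + -n by ring, _root_.fourier_add]
    simp only [RCLike.inner_apply, Pi.star_apply, RCLike.star_def, Complex.conj_conj]
    ring
  simp only [e0, e1, e2] at key
  have key2 := key.mul_left ((2 * Real.pi : ℝ) : ℂ)
  rw [mul_inv_cancel_left₀ hpi] at key2
  refine key2.congr_fun ?_
  intro m
  field_simp

/-! ### The Fourier transform of a product -/

lemma testFun_eq (n : ℤ) (ψ : 𝓢(ℝ, ℂ)) (p : Circle2Pi × ℝ) :
    testFun n ψ p = fourier (-n) p.1 * timeFactor ψ p.2 := rfl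

lemma derivX_testFun (n : ℤ) (ψ : 𝓢(ℝ, ℂ)) (p : Circle2Pi × ℝ) :
    derivX (testFun n ψ) p = -(Complex.I * n) * testFun n ψ p := by
  have h := hasDerivAt_fourier (2 * Real.pi) (-n) 0
  have h2 : HasDerivAt (fun y : ℝ => testFun n ψ (p.1 + (y : Circle2Pi), p.2))
      (-(Complex.I * n) * testFun n ψ p) 0 := by
    have e : (fun y : ℝ => testFun n ψ (p.1 + (y : Circle2Pi), p.2)) =
        fun y : ℝ => testFun n ψ p * fourier (-n) (y : Circle2Pi) := by
      ext y
      simp only [testFun_eq, fourier_apply, smul_add, AddCircle.toCircle_add, Circle.coe_mul]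
      ring
    rw [e]
    convert! h.const_mul (testFun n ψ p) using 1
    have : (Real.pi : ℂ) ≠ 0 := by exact_mod_cast Real.pi_ne_zero
    simp
    field_simp
  exact h2.deriv

lemma integrable_mul_testFun {v : SpaceTimeFun} (hv : MemLp v 2 volume) (n : ℤ)
    (ψ : 𝓢(ℝ, ℂ)) : Integrable (fun p => v p * testFun n ψ p) := by
  have h1 : MemLp (testFun n ψ) 2 volume := by
    have h := (memLp_timeFactor ψ).comp_snd (volume : Measure Circle2Pi)
    refine h.of_le_mul (c := 1) ?_ (Filter.Eventually.of_forall fun p => ?_)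
    · refine Continuous.aestronglyMeasurable ?_
      have := continuous_timeFactor ψ
      have h3 := map_continuous (fourier (T := 2 * Real.pi) (-n))
      exact (h3.comp continuous_fst).mul (this.comp continuous_snd)
    · rw [testFun_eq, norm_mul, norm_fourier_apply]
  exact hv.integrable_mul h1

/-- Each spatial Fourier coefficient of `v` is, as a function of time, the inverse Fourier transform
of the corresponding mode of the space-time Fourier transform. -/
lemma IsFourierTransform.ae_fourier_eq {v : SpaceTimeFun} {V : ℤ → ℝ → ℂ}
    (hV : IsFourierTransform (ofFun v) V) (hv : MemLp v 2 volume) (n : ℤ)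
    (hn : Integrable (V n)) :
    ∀ᵐ t : ℝ, ∫ x, v (x, t) * fourier (-n) x = invFT (V n) t := by
  refine ae_eq_of_integral_mul_timeFactor ?_ (continuous_invFT hn).locallyIntegrable fun ψ => ?_
  · rw [locallyIntegrable_iff]
    intro K hK
    have : IsFiniteMeasure ((volume : Measure ℝ).restrict K) :=
      ⟨by rw [Measure.restrict_apply_univ]; exact hK.measure_lt_top⟩
    have hle : (volume : Measure Circle2Pi).prod ((volume : Measure ℝ).restrict K) ≤ volume := by
      rw [Measure.volume_eq_prod]
      exact Measure.prod_mono le_rfl Measure.restrict_le_self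
    have h1 := (hv.mono_measure hle).integrable one_le_two
    have h2 : Integrable (fun p : Circle2Pi × ℝ => v p * fourier (-n) p.1)
        ((volume : Measure Circle2Pi).prod ((volume : Measure ℝ).restrict K)) := by
      refine h1.mul_bdd (c := 1) ?_ (Filter.Eventually.of_forall fun p => ?_)
      · exact ((map_continuous (fourier (-n))).comp continuous_fst).aestronglyMeasurable
      · rw [norm_fourier_apply]
    exact h2.integral_prod_right
  · rw [integral_invFT_mul_timeFactor hn, ← hV.apply_testFun n ψ, ofFun,
      Measure.volume_eq_prod, integral_prod_symm _ (integrable_mul_testFun hv n ψ)]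
    refine integral_congr_ae (Filter.Eventually.of_forall fun t => ?_)
    simp only [testFun_eq, ← mul_assoc]
    rw [integral_mul_const]

/-- The complex convolution of two modes. -/
def modeConv (f g : ℝ → ℂ) : ℝ → ℂ := convolution f g (ContinuousLinearMap.mul ℂ ℂ) volume

lemma enorm_modeConv_le (f g : ℝ → ℂ) (τ : ℝ) :
    ‖modeConv f g τ‖ₑ ≤ lconv (fun y => ‖f y‖ₑ) (fun y => ‖g y‖ₑ) τ := by
  refine (enorm_integral_le_lintegral_enorm _).trans (le_of_eq ?_)
  simp [lconv, enorm_mul]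

lemma lintegral_enorm_modeConv_le {f g : ℝ → ℂ} (hf : Measurable f) (hg : Measurable g) :
    ∫⁻ τ, ‖modeConv f g τ‖ₑ ≤ (∫⁻ τ, ‖f τ‖ₑ) * ∫⁻ τ, ‖g τ‖ₑ := by
  rw [← lintegral_lconv hf.enorm hg.enorm]
  exact lintegral_mono (enorm_modeConv_le f g)

/-- The series `∑ₘ V₁(m) * V₂(n - m)` for the `n`-th mode of a product. -/
def convSeries (V₁ V₂ : ℤ → ℝ → ℂ) (n : ℤ) (τ : ℝ) : ℂ :=
  ∑' m : ℤ, modeConv (V₁ m) (V₂ (n - m)) τ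

/-- The Fourier transform of `∂ₓ (v₁ v₂)` in terms of the Fourier transforms of `v₁` and `v₂`. -/
def derivProdFT (V₁ V₂ : ℤ → ℝ → ℂ) (n : ℤ) (τ : ℝ) : ℂ :=
  Complex.I * n * (((2 * Real.pi : ℝ) : ℂ)⁻¹ ^ 2 * convSeries V₁ V₂ n τ)

lemma enorm_convSeries_le (V₁ V₂ : ℤ → ℝ → ℂ) (n : ℤ) (τ : ℝ) :
    ‖convSeries V₁ V₂ n τ‖ₑ ≤
      ∑' m : ℤ, lconv (fun y => ‖V₁ m y‖ₑ) (fun y => ‖V₂ (n - m) y‖ₑ) τ :=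
  enorm_tsum_le_tsum_enorm.trans (ENNReal.tsum_le_tsum fun _ => enorm_modeConv_le _ _ τ)

lemma enorm_derivProdFT_le (V₁ V₂ : ℤ → ℝ → ℂ) (n : ℤ) (τ : ℝ) :
    ‖derivProdFT V₁ V₂ n τ‖ₑ ≤ ENNReal.ofReal |(n : ℝ)| *
      ∑' m : ℤ, lconv (fun y => ‖V₁ m y‖ₑ) (fun y => ‖V₂ (n - m) y‖ₑ) τ := by
  have h1 : ‖Complex.I * (n : ℂ)‖ₑ = ENNReal.ofReal |(n : ℝ)| := by
    rw [← ofReal_norm, norm_mul, Complex.norm_I, one_mul, Complex.norm_intCast]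
  have h2 : ‖((2 * Real.pi : ℝ) : ℂ)⁻¹ ^ 2‖ₑ ≤ 1 := by
    rw [← ofReal_norm, ENNReal.ofReal_le_one, norm_pow, norm_inv, Complex.norm_real,
      Real.norm_of_nonneg Real.two_pi_pos.le]
    exact pow_le_one₀ (by positivity) (inv_le_one_of_one_le₀ (by linarith [Real.pi_gt_three]))
  rw [derivProdFT, enorm_mul (Complex.I * (n : ℂ)), h1, enorm_mul]
  gcongr
  calc _ ≤ 1 * ‖convSeries V₁ V₂ n τ‖ₑ := by gcongr
    _ ≤ _ := by rw [one_mul]; exact enorm_convSeries_le _ _ _ _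

section

variable {V₁ V₂ : ℤ → ℝ → ℂ} {n : ℤ}

lemma aestronglyMeasurable_modeConv {f g : ℝ → ℂ} (hf : Measurable f) (hg : Measurable g) :
    AEStronglyMeasurable (modeConv f g) volume := by
  have : StronglyMeasurable fun p : ℝ × ℝ => f p.2 * g (p.1 - p.2) :=
    ((hf.comp measurable_snd).mul (hg.comp (measurable_fst.sub measurable_snd))).stronglyMeasurable
  exact this.integral_prod_right'.aestronglyMeasurable

lemma tsum_lintegral_modeConv_ne_top (h1 : ∀ m, Measurable (V₁ m)) (h2 : ∀ m, Measurable (V₂ m))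
    (hsum : ∑' m : ℤ, (∫⁻ τ, ‖V₁ m τ‖ₑ) * ∫⁻ τ, ‖V₂ (n - m) τ‖ₑ ≠ ∞) :
    ∑' m : ℤ, ∫⁻ τ, ‖modeConv (V₁ m) (V₂ (n - m)) τ‖ₑ ≠ ∞ :=
  ne_top_of_le_ne_top hsum
    (ENNReal.tsum_le_tsum fun m => lintegral_enorm_modeConv_le (h1 m) (h2 (n - m)))

lemma integrable_convSeries (h1 : ∀ m, Measurable (V₁ m)) (h2 : ∀ m, Measurable (V₂ m))
    (hsum : ∑' m : ℤ, (∫⁻ τ, ‖V₁ m τ‖ₑ) * ∫⁻ τ, ‖V₂ (n - m) τ‖ₑ ≠ ∞) :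
    Integrable (convSeries V₁ V₂ n) := by
  have hm : ∀ m, AEStronglyMeasurable (modeConv (V₁ m) (V₂ (n - m))) volume :=
    fun m => aestronglyMeasurable_modeConv (h1 m) (h2 (n - m))
  have hfin := tsum_lintegral_modeConv_ne_top h1 h2 hsum
  have hle : ∫⁻ τ, ∑' m : ℤ, ‖modeConv (V₁ m) (V₂ (n - m)) τ‖ₑ < ∞ := by
    rw [lintegral_tsum fun m => (hm m).enorm]
    exact hfin.lt_top
  refine ⟨?_, (lintegral_mono fun τ => enorm_tsum_le_tsum_enorm).trans_lt hle⟩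
  refine aestronglyMeasurable_of_tendsto_ae (Filter.atTop : Filter (Finset ℤ))
    (f := fun s τ => ∑ m ∈ s, modeConv (V₁ m) (V₂ (n - m)) τ)
    (fun s => Finset.aestronglyMeasurable_fun_sum s fun m _ => hm m) ?_
  filter_upwards [ae_lt_top' (AEMeasurable.tsum fun m => (hm m).enorm) hle.ne] with τ hτ
  exact (Summable.of_enorm hτ.ne).hasSum

end

lemma integral_invFT_mul_invFT {f g : ℝ → ℂ} (hf : Integrable f) (hg : Integrable g)
    (ψ : 𝓢(ℝ, ℂ)) :
    ∫ t, (invFT f t * invFT g t) * timeFactor ψ t =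
      ((2 * Real.pi : ℝ) : ℂ)⁻¹ * ∫ τ, modeConv f g τ * ψ τ := by
  have hc : Integrable (modeConv f g) := hf.integrable_convolution _ hg
  simp_rw [invFT_mul_invFT hf hg, mul_assoc]
  rw [integral_const_mul]
  congr 1
  exact integral_invFT_mul_timeFactor hc ψ

lemma enorm_invFT_le {f : ℝ → ℂ} (hf : Integrable f) (t : ℝ) :
    ‖invFT f t‖ₑ ≤ ∫⁻ τ, ‖f τ‖ₑ := by
  rw [← ofReal_norm, ← ofReal_integral_norm_eq_lintegral_enorm hf]
  exact ENNReal.ofReal_le_ofReal (norm_invFT_le f t)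

lemma exists_norm_schwartz_le (ψ : 𝓢(ℝ, ℂ)) : ∃ B : ℝ≥0, ∀ t, ‖ψ t‖ ≤ B := by
  refine ⟨⟨‖ψ.toBoundedContinuousFunction‖, norm_nonneg _⟩, fun t => ?_⟩
  exact ψ.toBoundedContinuousFunction.norm_coe_le_norm t

lemma ae_memLp_slice {v : SpaceTimeFun} (hv : MemLp v 2 volume) :
    ∀ᵐ t : ℝ, MemLp (fun x => v (x, t)) 2 volume := by
  have hm : ∀ᵐ t : ℝ, AEStronglyMeasurable (fun x => v (x, t)) volume := by
    have h := hv.1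
    rw [Measure.volume_eq_prod] at h
    exact h.prodMk_right
  have hi : Integrable (fun p => ‖v p‖ ^ 2) := (memLp_two_iff_integrable_sq_norm hv.1).1 hv
  rw [Measure.volume_eq_prod] at hi
  filter_upwards [hm, hi.prod_left_ae] with t h1 h2
  exact (memLp_two_iff_integrable_sq_norm h1).2 h2

/-- The modes of the product `v₁ v₂`, tested in time. Parseval's identity is applied at almost every
time; the hypothesis `hsum` allows the exchanges of sum and integral. -/
lemma integral_mul_testFun {v₁ v₂ : SpaceTimeFun} {V₁ V₂ : ℤ → ℝ → ℂ}
    (hv₁ : MemLp v₁ 2 volume) (hv₂ : MemLp v₂ 2 volume)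
    (hV₁ : IsFourierTransform (ofFun v₁) V₁) (hV₂ : IsFourierTransform (ofFun v₂) V₂)
    (m₁ : ∀ m, Measurable (V₁ m)) (m₂ : ∀ m, Measurable (V₂ m))
    (i₁ : ∀ m, Integrable (V₁ m)) (i₂ : ∀ m, Integrable (V₂ m)) (n : ℤ)
    (hsum : ∑' m : ℤ, (∫⁻ τ, ‖V₁ m τ‖ₑ) * ∫⁻ τ, ‖V₂ (n - m) τ‖ₑ ≠ ∞) (ψ : 𝓢(ℝ, ℂ)) :
    ∫ p, v₁ p * v₂ p * testFun n ψ p =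
      ∫ τ, ((2 * Real.pi : ℝ) : ℂ)⁻¹ ^ 2 * convSeries V₁ V₂ n τ * ψ τ := by
  set c : ℂ := ((2 * Real.pi : ℝ) : ℂ)⁻¹ with hc
  -- Fubini
  have hint : Integrable (fun p => v₁ p * v₂ p * testFun n ψ p)
      ((volume : Measure Circle2Pi).prod (volume : Measure ℝ)) := by
    obtain ⟨B, hB⟩ := exists_norm_schwartz_le (timeFactorSchwartz ψ)
    rw [timeFactorSchwartz_apply] at hB
    have h0 : Integrable (fun p => v₁ p * v₂ p) := hv₁.integrable_mul hv₂
    refine h0.mul_bdd (c := B) ?_ (Filter.Eventually.of_forall fun p => ?_)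
    · have h1 := continuous_timeFactor ψ
      have h3 := map_continuous (fourier (T := 2 * Real.pi) (-n))
      exact ((h3.comp continuous_fst).mul (h1.comp continuous_snd)).aestronglyMeasurable
    · rw [testFun_eq, norm_mul, norm_fourier_apply, one_mul]
      exact hB _
  have s1 : ∫ p, v₁ p * v₂ p * testFun n ψ p =
      ∫ t, (∫ x, v₁ (x, t) * v₂ (x, t) * fourier (-n) x) * timeFactor ψ t := by
    rw [Measure.volume_eq_prod, integral_prod_symm _ hint]
    refine integral_congr_ae (Filter.Eventually.of_forall fun t => ?_)
    simp only [testFun_eq, ← mul_assoc]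
    rw [integral_mul_const]
  -- Parseval at almost every time
  have s2 : ∫ t, (∫ x, v₁ (x, t) * v₂ (x, t) * fourier (-n) x) * timeFactor ψ t =
      ∫ t, ∑' m : ℤ, c * ((invFT (V₁ m) t * invFT (V₂ (n - m)) t) * timeFactor ψ t) := by
    refine integral_congr_ae ?_
    filter_upwards [ae_memLp_slice hv₁, ae_memLp_slice hv₂,
      ae_all_iff.2 fun m => hV₁.ae_fourier_eq hv₁ m (i₁ m),
      ae_all_iff.2 fun m => hV₂.ae_fourier_eq hv₂ m (i₂ m)] with t a1 a2 b1 b2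
    rw [← (hasSum_fourier_mul a1 a2 n).tsum_eq, ← tsum_mul_right]
    simp only [b1, b2, hc, mul_assoc]
  -- exchange of sum and integral, before and after returning to the frequency side
  have s3 : ∫ t, ∑' m : ℤ, c * ((invFT (V₁ m) t * invFT (V₂ (n - m)) t) * timeFactor ψ t) =
      ∑' m : ℤ, ∫ t, c * ((invFT (V₁ m) t * invFT (V₂ (n - m)) t) * timeFactor ψ t) := by
    refine integral_tsum (fun m => ?_) ?_
    · have c1 := continuous_invFT (i₁ m)
      have c2 := continuous_invFT (i₂ (n - m))
      have c3 := continuous_timeFactor ψ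
      exact Continuous.aestronglyMeasurable (by fun_prop)
    · have hT : ∫⁻ t, ‖timeFactor ψ t‖ₑ ≠ ∞ := (integrable_timeFactor ψ).2.ne
      refine ne_top_of_le_ne_top (ENNReal.mul_ne_top
        (ENNReal.mul_ne_top (enorm_ne_top (x := c)) hsum) hT) ?_
      rw [← ENNReal.tsum_mul_left, ← ENNReal.tsum_mul_right]
      refine ENNReal.tsum_le_tsum fun m => ?_
      rw [← lintegral_const_mul _ (continuous_timeFactor ψ).measurable.enorm]
      refine lintegral_mono fun t => ?_
      rw [enorm_mul, enorm_mul, enorm_mul, mul_assoc ‖c‖ₑ]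
      gcongr
      · exact enorm_invFT_le (i₁ m) t
      · exact enorm_invFT_le (i₂ (n - m)) t
  have s5 : ∫ τ, c ^ 2 * convSeries V₁ V₂ n τ * ψ τ =
      ∑' m : ℤ, ∫ τ, c ^ 2 * (modeConv (V₁ m) (V₂ (n - m)) τ * ψ τ) := by
    rw [← integral_tsum]
    · refine integral_congr_ae (Filter.Eventually.of_forall fun τ => ?_)
      simp only [convSeries]
      rw [tsum_mul_left, tsum_mul_right, mul_assoc]
    · intro m
      exact ((aestronglyMeasurable_modeConv (m₁ m) (m₂ (n - m))).mul
        ψ.continuous.aestronglyMeasurable).const_mul _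
    · obtain ⟨B, hB⟩ := exists_norm_schwartz_le ψ
      refine ne_top_of_le_ne_top (ENNReal.mul_ne_top (ENNReal.mul_ne_top (enorm_ne_top (x := c ^ 2))
        (tsum_lintegral_modeConv_ne_top m₁ m₂ hsum)) (ENNReal.coe_ne_top (r := B))) ?_
      rw [← ENNReal.tsum_mul_left, ← ENNReal.tsum_mul_right]
      refine ENNReal.tsum_le_tsum fun m => ?_
      rw [← lintegral_const_mul'' _ (aestronglyMeasurable_modeConv (m₁ m) (m₂ (n - m))).enorm,
        ← lintegral_mul_const' _ _ ENNReal.coe_ne_top]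
      refine lintegral_mono fun τ => ?_
      rw [enorm_mul, enorm_mul, mul_assoc]
      gcongr
      rw [enorm_le_coe]
      exact hB τ
  rw [s1, s2, s3, s5]
  refine tsum_congr fun m => ?_
  rw [integral_const_mul, integral_const_mul, integral_invFT_mul_invFT (i₁ m) (i₂ (n - m)), pow_two,
    mul_assoc]

/-- The Fourier transform of `∂ₓ (v₁ v₂)`. -/
lemma isFourierTransform_derivProdFT {v₁ v₂ : SpaceTimeFun} {V₁ V₂ : ℤ → ℝ → ℂ}
    (hv₁ : MemLp v₁ 2 volume) (hv₂ : MemLp v₂ 2 volume)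
    (hV₁ : IsFourierTransform (ofFun v₁) V₁) (hV₂ : IsFourierTransform (ofFun v₂) V₂)
    (m₁ : ∀ m, Measurable (V₁ m)) (m₂ : ∀ m, Measurable (V₂ m))
    (i₁ : ∀ m, Integrable (V₁ m)) (i₂ : ∀ m, Integrable (V₂ m))
    (hsum : ∀ n : ℤ, ∑' m : ℤ, (∫⁻ τ, ‖V₁ m τ‖ₑ) * ∫⁻ τ, ‖V₂ (n - m) τ‖ₑ ≠ ∞) :
    IsFourierTransform (distDerivX (ofFun fun p => v₁ p * v₂ p)) (derivProdFT V₁ V₂) := by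
  have hi : ∀ n, Integrable (derivProdFT V₁ V₂ n) := fun n =>
    ((integrable_convSeries m₁ m₂ (hsum n)).const_mul _).const_mul _
  refine ⟨fun n => (hi n).1, fun n ψ => ?_, fun n ψ => ?_⟩
  · obtain ⟨B, hB⟩ := exists_norm_schwartz_le ψ
    exact (hi n).mul_bdd ψ.continuous.aestronglyMeasurable (Filter.Eventually.of_forall hB)
  · have e : ∀ p, v₁ p * v₂ p * derivX (testFun n ψ) p =
        -(Complex.I * n) * (v₁ p * v₂ p * testFun n ψ p) := by
      intro p; rw [derivX_testFun]; ring
    simp only [distDerivX, ofFun, e]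
    rw [integral_const_mul,
      integral_mul_testFun hv₁ hv₂ hV₁ hV₂ m₁ m₂ i₁ i₂ n (hsum n) ψ, neg_mul, neg_neg,
      ← integral_const_mul]
    simp only [derivProdFT, mul_assoc]

/-! ### The norms in terms of single modes -/

lemma eLpNorm_weighted (α s b : ℝ) (V : ℤ → ℝ → ℂ) (n : ℤ) (p : ℝ≥0∞) :
    eLpNorm (weighted α s b V n) p volume = ENNReal.ofReal (jb n ^ s) *
      eLpNorm (fun τ => modWeight (α * (n : ℝ) ^ 3) b τ * ‖V n τ‖ₑ) p volume := by
  have h0 := jb_rpow_nonneg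
  have e1 : weighted α s b V n = ((jb n ^ s : ℝ) : ℂ) •
      fun τ => ((jb (τ - α * (n : ℝ) ^ 3) ^ b : ℝ) : ℂ) * V n τ := by
    ext τ
    simp only [weighted, Pi.smul_apply, smul_eq_mul]
    push_cast
    ring
  rw [e1, eLpNorm_const_smul, ← ofReal_norm, Complex.norm_real, Real.norm_of_nonneg (h0 _ _)]
  congr 1
  refine eLpNorm_congr_enorm_ae (Filter.Eventually.of_forall fun τ => ?_)
  rw [enorm_mul, ← ofReal_norm, Complex.norm_real, Real.norm_of_nonneg (h0 _ _), enorm_eq_self]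
  rfl

/-- `modeNorm` of the `n`-th mode of a space-time Fourier transform, with modulation measured from
`α n³`. -/
def mode (α : ℝ) (V : ℤ → ℝ → ℂ) (n : ℤ) : ℝ≥0∞ :=
  modeNorm (α * (n : ℝ) ^ 3) fun τ => ‖V n τ‖ₑ

lemma weight_mul_mode (α s : ℝ) (V : ℤ → ℝ → ℂ) (n : ℤ) :
    ENNReal.ofReal (jb n ^ s) * mode α V n =
      eLpNorm (weighted α s (1 / 2) V n) 2 volume + eLpNorm (weighted α s 0 V n) 1 volume := by
  rw [eLpNorm_weighted, eLpNorm_weighted, mode, modeNorm, mul_add]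
  congr 2
  rw [eLpNorm_one_eq_lintegral_enorm]
  simp [modWeight]

lemma eLpNorm_weight_mul_mode_le (α s : ℝ) (V : ℤ → ℝ → ℂ) :
    eLpNorm (fun n : ℤ => ENNReal.ofReal (jb n ^ s) * mode α V n) 2 Measure.count ≤
      hatYNorm α s V := by
  simp_rw [weight_mul_mode]
  exact eLpNorm_add_le (measurable_of_countable _).aestronglyMeasurable
    (measurable_of_countable _).aestronglyMeasurable (by norm_num)

lemma weight_mul_mode_le (α s : ℝ) (V : ℤ → ℝ → ℂ) (n : ℤ) :
    ENNReal.ofReal (jb n ^ s) * mode α V n ≤ hatYInftyNorm α s V := by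
  rw [weight_mul_mode, hatYInftyNorm]
  refine add_le_add ?_ ?_
  · exact enorm_le_eLpNorm_count (p := ∞)
      (fun n : ℤ => eLpNorm (weighted α s (1 / 2) V n) 2 volume) n (by simp)
  · exact enorm_le_eLpNorm_count (p := ∞)
      (fun n : ℤ => eLpNorm (weighted α s 0 V n) 1 volume) n (by simp)

lemma mode_le_weight_mul (α : ℝ) {s : ℝ} (hs : 0 ≤ s) (V : ℤ → ℝ → ℂ) (n : ℤ) :
    mode α V n ≤ ENNReal.ofReal (jb n ^ s) * mode α V n := by
  refine le_mul_of_one_le_left zero_le ?_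
  rw [ENNReal.one_le_ofReal]
  exact Real.one_le_rpow (one_le_jb _) hs

/-- The Cauchy-Schwarz inequality for a discrete convolution. -/
lemma tsum_mul_sub_le (β₁ β₂ : ℤ → ℝ≥0∞) (n : ℤ) :
    ∑' m : ℤ, β₁ m * β₂ (n - m) ≤ eLpNorm β₁ 2 Measure.count * eLpNorm β₂ 2 Measure.count := by
  have h := lintegral_mul_le_eLpNorm_two (μ := Measure.count) (measurable_of_countable β₁)
    (measurable_of_countable fun m => β₂ (n - m))
  rw [lintegral_count] at h
  refine h.trans_eq ?_
  congr 1
  rw [eLpNorm_eq_lintegral_rpow_enorm_toReal (by norm_num) (by norm_num),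
    eLpNorm_eq_lintegral_rpow_enorm_toReal (by norm_num) (by norm_num), lintegral_count,
    lintegral_count]
  congr 1
  exact (Equiv.subLeft n).tsum_eq fun m => ‖β₂ m‖ₑ ^ ENNReal.toReal 2

/-! ### Summation over the interactions -/

/-- The sum of the two norms of the space `Y_α^{s₁,s₂}`. -/
def hatNorm (α s₁ s₂ : ℝ) (V : ℤ → ℝ → ℂ) : ℝ≥0∞ := hatYNorm α s₁ V + hatYInftyNorm α s₂ V

/-- A bound for every interaction gains the square root of the resonance function; summed over all
interactions with output `n`, it yields a bound with the full weight. The `ℓ²` norms take care of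
the generic interactions and the `ℓ^∞` norms of the nearly resonant ones. -/
lemma tsum_weight_mul_le {α s₁ s₂ C : ℝ} (c : ℝ) (hC : 0 ≤ C) (V₁ V₂ : ℤ → ℝ → ℂ) (n : ℤ)
    (hw : ∀ m : ℤ, |(n : ℝ)| * jb n ^ s₂ ≤
      C * jb (resonance α n m) ^ (1 / 2 : ℝ) * (jb m ^ s₁ * jb (n - m : ℤ) ^ s₁ +
        if m ∈ nearResonant c n then jb m ^ s₂ * jb (n - m : ℤ) ^ s₂ else 0))
    (T : ℤ → ℝ≥0∞) (A : ℝ≥0∞)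
    (hT : ∀ m, ENNReal.ofReal (jb (resonance α n m) ^ (1 / 2 : ℝ)) * T m ≤
      A * (mode α V₁ m * mode α V₂ (n - m))) :
    ∑' m, ENNReal.ofReal (|(n : ℝ)| * jb n ^ s₂) * T m ≤
      3 * ENNReal.ofReal C * A * (hatNorm α s₁ s₂ V₁ * hatNorm α s₁ s₂ V₂) := by
  set β₁ : ℝ → ℤ → ℝ≥0∞ := fun s m => ENNReal.ofReal (jb m ^ s) * mode α V₁ m with hβ₁
  set β₂ : ℝ → ℤ → ℝ≥0∞ := fun s m => ENNReal.ofReal (jb m ^ s) * mode α V₂ m with hβ₂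
  set Y := hatNorm α s₁ s₂ V₁ * hatNorm α s₁ s₂ V₂
  have h0 := jb_rpow_nonneg
  have hterm : ∀ m, ENNReal.ofReal (|(n : ℝ)| * jb n ^ s₂) * T m ≤
      ENNReal.ofReal C * A * (β₁ s₁ m * β₂ s₁ (n - m) +
        if m ∈ nearResonant c n then β₁ s₂ m * β₂ s₂ (n - m) else 0) := by
    intro m
    set w : ℝ := jb m ^ s₁ * jb (n - m : ℤ) ^ s₁ +
      if m ∈ nearResonant c n then jb m ^ s₂ * jb (n - m : ℤ) ^ s₂ else 0 with hwdef
    have hsplit : ENNReal.ofReal w * (mode α V₁ m * mode α V₂ (n - m)) =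
        β₁ s₁ m * β₂ s₁ (n - m) +
          if m ∈ nearResonant c n then β₁ s₂ m * β₂ s₂ (n - m) else 0 := by
      rw [hwdef]
      split_ifs
      · rw [ENNReal.ofReal_add (mul_nonneg (h0 _ _) (h0 _ _)) (mul_nonneg (h0 _ _) (h0 _ _)),
          ENNReal.ofReal_mul (h0 _ _), ENNReal.ofReal_mul (h0 _ _)]
        simp only [hβ₁, hβ₂]
        ring
      · rw [add_zero, add_zero, ENNReal.ofReal_mul (h0 _ _)]
        simp only [hβ₁, hβ₂]
        ring
    calc ENNReal.ofReal (|(n : ℝ)| * jb n ^ s₂) * T m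
        ≤ ENNReal.ofReal (C * jb (resonance α n m) ^ (1 / 2 : ℝ) * w) * T m :=
          mul_le_mul' (ENNReal.ofReal_le_ofReal (hw m)) le_rfl
      _ = ENNReal.ofReal C * ENNReal.ofReal w *
            (ENNReal.ofReal (jb (resonance α n m) ^ (1 / 2 : ℝ)) * T m) := by
          rw [ENNReal.ofReal_mul (mul_nonneg hC (h0 _ _)), ENNReal.ofReal_mul hC]
          ring
      _ ≤ ENNReal.ofReal C * ENNReal.ofReal w * (A * (mode α V₁ m * mode α V₂ (n - m))) :=
          mul_le_mul' le_rfl (hT m)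
      _ = ENNReal.ofReal C * A * (ENNReal.ofReal w * (mode α V₁ m * mode α V₂ (n - m))) := by ring
      _ = _ := by rw [hsplit]
  have hgen : ∑' m, β₁ s₁ m * β₂ s₁ (n - m) ≤ Y := by
    refine (tsum_mul_sub_le _ _ n).trans (mul_le_mul' ?_ ?_)
    · exact (eLpNorm_weight_mul_mode_le α s₁ V₁).trans (le_add_right le_rfl)
    · exact (eLpNorm_weight_mul_mode_le α s₁ V₂).trans (le_add_right le_rfl)
  have hone : ∀ m, β₁ s₂ m * β₂ s₂ (n - m) ≤ Y := fun m => mul_le_mul'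
    ((weight_mul_mode_le α s₂ V₁ m).trans (le_add_left le_rfl))
    ((weight_mul_mode_le α s₂ V₂ (n - m)).trans (le_add_left le_rfl))
  have hres : ∑' m, (if m ∈ nearResonant c n then β₁ s₂ m * β₂ s₂ (n - m) else 0) ≤ 2 * Y := by
    rw [tsum_eq_sum (s := nearResonant c n) fun m hm => if_neg hm]
    calc _ ≤ ∑ _m ∈ nearResonant c n, Y := Finset.sum_le_sum fun m hm => by
          rw [if_pos hm]; exact hone m
      _ ≤ 2 * Y := by
          rw [Finset.sum_const, nsmul_eq_mul]
          gcongr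
          exact_mod_cast Finset.card_le_two
  calc _ ≤ ∑' m, ENNReal.ofReal C * A * (β₁ s₁ m * β₂ s₁ (n - m) +
        if m ∈ nearResonant c n then β₁ s₂ m * β₂ s₂ (n - m) else 0) := ENNReal.tsum_le_tsum hterm
    _ ≤ ENNReal.ofReal C * A * (Y + 2 * Y) := by
        rw [ENNReal.tsum_mul_left, ENNReal.tsum_add]
        gcongr
    _ = _ := by ring

section

variable {V₁ V₂ : ℤ → ℝ → ℂ}

lemma eLpNorm_two_weighted_derivProdFT_le (s : ℝ) (h1 : ∀ m, Measurable (V₁ m))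
    (h2 : ∀ m, Measurable (V₂ m)) (n : ℤ) :
    eLpNorm (weighted 1 s (-1 / 2) (derivProdFT V₁ V₂) n) 2 volume ≤
      ∑' m : ℤ, ENNReal.ofReal (|(n : ℝ)| * jb n ^ s) *
        eLpNorm (fun τ => modWeight ((n : ℝ) ^ 3) (-1 / 2) τ *
          lconv (fun y => ‖V₁ m y‖ₑ) (fun y => ‖V₂ (n - m) y‖ₑ) τ) 2 volume := by
  have hm : ∀ m, Measurable fun τ => modWeight ((n : ℝ) ^ 3) (-1 / 2) τ *
      lconv (fun y => ‖V₁ m y‖ₑ) (fun y => ‖V₂ (n - m) y‖ₑ) τ := fun m =>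
    (measurable_modWeight _ _).mul (measurable_lconv (h1 m).enorm (h2 (n - m)).enorm)
  rw [eLpNorm_weighted, one_mul, ENNReal.tsum_mul_left, mul_comm |(n : ℝ)|,
    ENNReal.ofReal_mul (jb_rpow_nonneg _ _), mul_assoc]
  gcongr
  have hle : ∀ τ, ‖modWeight ((n : ℝ) ^ 3) (-1 / 2) τ * ‖derivProdFT V₁ V₂ n τ‖ₑ‖ₑ ≤
      ENNReal.ofReal |(n : ℝ)| * ‖∑' m : ℤ, modWeight ((n : ℝ) ^ 3) (-1 / 2) τ *
          lconv (fun y => ‖V₁ m y‖ₑ) (fun y => ‖V₂ (n - m) y‖ₑ) τ‖ₑ := by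
    intro τ
    rw [enorm_eq_self, enorm_eq_self, ENNReal.tsum_mul_left, mul_left_comm]
    gcongr
    exact enorm_derivProdFT_le V₁ V₂ n τ
  refine (eLpNorm_le_nnreal_smul_eLpNorm_of_ae_le_mul' (c := Real.toNNReal |(n : ℝ)|)
    (Filter.Eventually.of_forall hle) 2).trans ?_
  rw [ENNReal.smul_def, smul_eq_mul]
  exact mul_le_mul' le_rfl (eLpNorm_tsum_le hm)

lemma eLpNorm_one_weighted_derivProdFT_le (s : ℝ) (h1 : ∀ m, Measurable (V₁ m))
    (h2 : ∀ m, Measurable (V₂ m)) (n : ℤ) :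
    eLpNorm (weighted 1 s (-1) (derivProdFT V₁ V₂) n) 1 volume ≤
      ∑' m : ℤ, ENNReal.ofReal (|(n : ℝ)| * jb n ^ s) *
        ∫⁻ τ, modWeight ((n : ℝ) ^ 3) (-1) τ *
          lconv (fun y => ‖V₁ m y‖ₑ) (fun y => ‖V₂ (n - m) y‖ₑ) τ := by
  have hm : ∀ m, Measurable fun τ => modWeight ((n : ℝ) ^ 3) (-1) τ *
      lconv (fun y => ‖V₁ m y‖ₑ) (fun y => ‖V₂ (n - m) y‖ₑ) τ := fun m =>
    (measurable_modWeight _ _).mul (measurable_lconv (h1 m).enorm (h2 (n - m)).enorm)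
  rw [eLpNorm_weighted, one_mul, ENNReal.tsum_mul_left, mul_comm |(n : ℝ)|,
    ENNReal.ofReal_mul (jb_rpow_nonneg _ _), mul_assoc]
  gcongr
  rw [eLpNorm_one_eq_lintegral_enorm, ← lintegral_tsum fun m => (hm m).aemeasurable,
    ← lintegral_const_mul' _ _ ENNReal.ofReal_ne_top]
  refine lintegral_mono fun τ => ?_
  rw [enorm_eq_self, ENNReal.tsum_mul_left, mul_left_comm]
  gcongr
  exact enorm_derivProdFT_le V₁ V₂ n τ

end

/-- The bilinear estimate on the Fourier side. -/
lemma hatZInftyNorm_derivProdFT_le {α s₁ s₂ C : ℝ} (c : ℝ) (hC : 0 ≤ C) {V₁ V₂ : ℤ → ℝ → ℂ}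
    (h1 : ∀ m, Measurable (V₁ m)) (h2 : ∀ m, Measurable (V₂ m))
    (hw : ∀ n m : ℤ, |(n : ℝ)| * jb n ^ s₂ ≤
      C * jb (resonance α n m) ^ (1 / 2 : ℝ) * (jb m ^ s₁ * jb (n - m : ℤ) ^ s₁ +
        if m ∈ nearResonant c n then jb m ^ s₂ * jb (n - m : ℤ) ^ s₂ else 0)) :
    hatZInftyNorm s₂ (derivProdFT V₁ V₂) ≤
      (3 * ENNReal.ofReal C * 3 + 3 * ENNReal.ofReal C * (1 + 2 * weightConst)) *
        (hatNorm α s₁ s₂ V₁ * hatNorm α s₁ s₂ V₂) := by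
  rw [hatZInftyNorm, add_mul]
  refine add_le_add ?_ ?_
  · rw [mixedNorm, eLpNorm_exponent_top, eLpNormEssSup_count]
    refine iSup_le fun n => ?_
    rw [enorm_eq_self]
    refine (eLpNorm_two_weighted_derivProdFT_le s₂ h1 h2 n).trans ?_
    exact tsum_weight_mul_le c hC V₁ V₂ n (hw n) _ 3 fun m =>
      resonance_mul_eLpNorm_le (h1 m).enorm (h2 (n - m)).enorm _ _ _
  · rw [mixedNorm, eLpNorm_exponent_top, eLpNormEssSup_count]
    refine iSup_le fun n => ?_
    rw [enorm_eq_self]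
    refine (eLpNorm_one_weighted_derivProdFT_le s₂ h1 h2 n).trans ?_
    exact tsum_weight_mul_le c hC V₁ V₂ n (hw n) _ _ fun m =>
      resonance_mul_lintegral_le (h1 m).enorm (h2 (n - m)).enorm _ _ _

/-- The modes of a Fourier transform may be taken measurable. -/
lemma IsFourierTransform.exists_measurable {u : Functional} {V : ℤ → ℝ → ℂ}
    (hV : IsFourierTransform u V) (α s₁ s₂ : ℝ) :
    ∃ V' : ℤ → ℝ → ℂ, (∀ n, Measurable (V' n)) ∧ IsFourierTransform u V' ∧
      hatNorm α s₁ s₂ V' = hatNorm α s₁ s₂ V := by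
  refine ⟨fun n => (hV.aestronglyMeasurable n).mk, fun n =>
    (hV.aestronglyMeasurable n).stronglyMeasurable_mk.measurable, ?_, ?_⟩
  · have hae := fun n => (hV.aestronglyMeasurable n).ae_eq_mk
    refine ⟨fun n => (hV.aestronglyMeasurable n).stronglyMeasurable_mk.aestronglyMeasurable,
      fun n ψ => (hV.integrable n ψ).congr ?_, fun n ψ => (hV.apply_testFun n ψ).trans ?_⟩
    · filter_upwards [hae n] with τ h
      rw [h]
    · refine integral_congr_ae ?_
      filter_upwards [hae n] with τ h
      rw [h]
  · have key : ∀ s b p n, eLpNorm (weighted α s b (fun n => (hV.aestronglyMeasurable n).mk) n) p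
        volume = eLpNorm (weighted α s b V n) p volume := by
      intro s b p n
      refine eLpNorm_congr_ae ?_
      filter_upwards [(hV.aestronglyMeasurable n).ae_eq_mk] with τ h
      simp only [weighted, ← h]
    simp only [hatNorm, hatYNorm, hatYInftyNorm, mixedNorm, key]

lemma integrable_of_hatNorm_lt_top {α s₁ s₂ : ℝ} (hs : 0 ≤ s₂) {V : ℤ → ℝ → ℂ}
    (hm : ∀ n, Measurable (V n)) (h : hatNorm α s₁ s₂ V < ∞) (n : ℤ) : Integrable (V n) := by
  refine ⟨(hm n).aestronglyMeasurable, lt_of_le_of_lt ?_ h⟩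
  calc ∫⁻ τ, ‖V n τ‖ₑ ≤ mode α V n := le_add_left le_rfl
    _ ≤ ENNReal.ofReal (jb n ^ s₂) * mode α V n := mode_le_weight_mul α hs V n
    _ ≤ hatYInftyNorm α s₂ V := weight_mul_mode_le α s₂ V n
    _ ≤ _ := le_add_left le_rfl

lemma tsum_lintegral_mul_ne_top {α s₁ s₂ : ℝ} (hs : 0 ≤ s₁) {V₁ V₂ : ℤ → ℝ → ℂ}
    (h1 : hatNorm α s₁ s₂ V₁ < ∞) (h2 : hatNorm α s₁ s₂ V₂ < ∞) (n : ℤ) :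
    ∑' m : ℤ, (∫⁻ τ, ‖V₁ m τ‖ₑ) * ∫⁻ τ, ‖V₂ (n - m) τ‖ₑ ≠ ∞ := by
  refine ne_top_of_le_ne_top (ENNReal.mul_lt_top h1 h2).ne ?_
  have hle : ∀ (V : ℤ → ℝ → ℂ) (m : ℤ),
      ∫⁻ τ, ‖V m τ‖ₑ ≤ ENNReal.ofReal (jb m ^ s₁) * mode α V m := fun V m =>
    (show ∫⁻ τ, ‖V m τ‖ₑ ≤ mode α V m from le_add_left le_rfl).trans (mode_le_weight_mul α hs V m)
  refine (ENNReal.tsum_le_tsum fun m => mul_le_mul' (hle V₁ m) (hle V₂ (n - m))).trans ?_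
  refine (tsum_mul_sub_le (fun m => ENNReal.ofReal (jb m ^ s₁) * mode α V₁ m)
    (fun m => ENNReal.ofReal (jb m ^ s₁) * mode α V₂ m) n).trans (mul_le_mul' ?_ ?_)
  · exact (eLpNorm_weight_mul_mode_le α s₁ V₁).trans (le_add_right le_rfl)
  · exact (eLpNorm_weight_mul_mode_le α s₁ V₂).trans (le_add_right le_rfl)

lemma exists_hatNorm_lt {α s₁ s₂ : ℝ} {v : SpaceTimeFun} {a : ℝ≥0∞} (h : yNorm α s₁ s₂ v < a) :
    ∃ V : ℤ → ℝ → ℂ, (∀ n, Measurable (V n)) ∧ IsFourierTransform (ofFun v) V ∧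
      hatNorm α s₁ s₂ V < a := by
  simp only [yNorm, iInf_lt_iff] at h
  obtain ⟨V, hV, hlt⟩ := h
  obtain ⟨V', hm, hV', he⟩ := hV.exists_measurable α s₁ s₂
  exact ⟨V', hm, hV', he.trans_lt hlt⟩

end MajdaBiello

end

theorem mainTheorem4 (α s₁ s₂ : ℝ) (hα : 0 < α) (hα4 : α ≤ 4)
    (hν : MajdaBiello.minimalTypeIndex (MajdaBiello.c₁ α) < 1)
    (h1 : 1 / 4 ≤ s₁) (h2 : s₁ < 1 / 2) (h3 : 1 / 2 < s₂) (h4 : s₂ < 1)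
    (h5 : s₂ < 2 * s₁)
    (h6 : 1 / 2 + MajdaBiello.minimalTypeIndex (MajdaBiello.c₁ α) / 2 < ENNReal.ofReal s₂) :
    ∃ C : ℝ≥0, ∀ v₁ v₂ : MajdaBiello.SpaceTimeFun,
      MajdaBiello.MemY α s₁ s₂ v₁ → MajdaBiello.MemY α s₁ s₂ v₂ →
        MajdaBiello.zInftyNorm s₂
            (MajdaBiello.distDerivX (MajdaBiello.ofFun fun p => v₁ p * v₂ p)) ≤
          C * MajdaBiello.yNorm α s₁ s₂ v₁ * MajdaBiello.yNorm α s₁ s₂ v₂ := by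
  open MajdaBiello in
  obtain ⟨ν, -, hν2, hT⟩ := exists_isOfType_of_index_lt hν h6
  have hc : 1 / 2 ≤ c₁ α := le_add_of_nonneg_right (by positivity)
  obtain ⟨C, hC, hw⟩ := exists_weight_le α s₁ s₂ (c₁ α) ν hα hc hν2 hT h2 h3 h4 h5
  simp only [← resonance_eq α hα hα4] at hw
  set D : ℝ≥0∞ := 3 * ENNReal.ofReal C * 3 + 3 * ENNReal.ofReal C * (1 + 2 * weightConst) with hD
  have hDtop : D ≠ ∞ := by
    have := weightConst_lt_top.ne
    finiteness
  lift D to ℝ≥0 using hDtop with D'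
  refine ⟨D', fun v₁ v₂ hv₁ hv₂ => ?_⟩
  -- the infima in the two norms are approached by Fourier transforms with measurable modes
  have key : ∀ a b : ℝ≥0∞, yNorm α s₁ s₂ v₁ < a → yNorm α s₁ s₂ v₂ < b →
      zInftyNorm s₂ (distDerivX (ofFun fun p => v₁ p * v₂ p)) ≤ D' * a * b := by
    intro a b ha hb
    obtain ⟨V₁, m₁, hV₁, hlt₁⟩ := exists_hatNorm_lt ha
    obtain ⟨V₂, m₂, hV₂, hlt₂⟩ := exists_hatNorm_lt hb
    have f₁ := hlt₁.trans_le le_top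
    have f₂ := hlt₂.trans_le le_top
    have hFT := isFourierTransform_derivProdFT hv₁.1 hv₂.1 hV₁ hV₂ m₁ m₂
      (integrable_of_hatNorm_lt_top (by linarith) m₁ f₁)
      (integrable_of_hatNorm_lt_top (by linarith) m₂ f₂)
      (tsum_lintegral_mul_ne_top (by linarith) f₁ f₂)
    calc _ ≤ hatZInftyNorm s₂ (derivProdFT V₁ V₂) := iInf₂_le _ hFT
      _ ≤ D' * (hatNorm α s₁ s₂ V₁ * hatNorm α s₁ s₂ V₂) := by
          rw [hD]; exact hatZInftyNorm_derivProdFT_le (c₁ α) hC.le m₁ m₂ hw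
      _ ≤ D' * (a * b) := by gcongr
      _ = _ := (mul_assoc _ _ _).symm
  have t₁ := hv₁.2
  have t₂ := hv₂.2
  generalize yNorm α s₁ s₂ v₁ = y₁ at key t₁ ⊢
  generalize yNorm α s₁ s₂ v₂ = y₂ at key t₂ ⊢
  lift y₁ to ℝ≥0 using t₁.ne
  lift y₂ to ℝ≥0 using t₂.ne
  have hcont : Continuous fun ε : ℝ≥0 => ((D' * (y₁ + ε) * (y₂ + ε) : ℝ≥0) : ℝ≥0∞) :=
    ENNReal.continuous_coe.comp (by fun_prop)
  have hlim := (hcont.tendsto 0).mono_left (nhdsWithin_le_nhds (s := Set.Ioi 0))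
  simp only [add_zero, ENNReal.coe_mul] at hlim
  refine ge_of_tendsto hlim ?_
  filter_upwards [self_mem_nhdsWithin] with ε hε
  have hε' : (0 : ℝ≥0) < ε := hε
  exact key _ _ (by exact_mod_cast lt_add_of_pos_right y₁ hε')
    (by exact_mod_cast lt_add_of_pos_right y₂ hε')
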